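/- Let $(\mathcal M,\mathfrak g)$ be a geodesically complete smooth Riemannian manifold of finite dimension, so that the exponential map $\mathrm{Exp}_x:T_x\mathcal M\to\mathcal M$ is defined on every tangent space. Let $n\ge 1$, let $f_1,\dots,f_n:\mathcal M\to\mathbb R$ be differentiable, put $f=\frac1n\sum_{i=1}^n f_i$, and let $\nabla$ denote the Riemannian gradient. Assume: * (geodesic $L$-smoothness, $L>0$) for every $i$ and every geodesic $c:[0,1]\to\mathcal M$ with $c(0)=y$, $c(1)=x$, one has $\|\nabla f_i(x)-\Gamma_y^x\nabla f_i(y)\|\le L\|\dot c(0)\|$, where $\Gamma_y^x$ is parallel transport along $c$ (if any two points are joined by a unique geodesic, then $\|\dot c(0)\|=\|\mathrm{Exp}_x^{-1}(y)\|$); * (Polyak–Łojasiewicz condition) there are $\mu>0$ and $f^*\in\mathbb R$ with $f(x)\ge f^*$ and $2\mu\,(f(x)-f^*)\le\|\nabla f(x)\|^2$ for all $x\in\mathcal M$; * (unbiased compressors) $\omega\ge0$, and $\mathcal Q_1,\dots,\mathcal Q_n$ are stochastic mappings $T_x\mathcal M\to T_x\mathcal M$ ($x\in\mathcal M$) such that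 $\mathbb E[\mathcal Q_i(y)]=y$ and $\mathbb E\|\mathcal Q_i(y)-y\|^2\le\omega\|y\|^2$ for all $x\in\mathcal M$ and $y\in T_x\mathcal M$. Let $p\in(0,1]$, let $x^0\in\mathcal M$, and let the stepsize $\gamma>0$ satisfy $$\gamma\le\min\left\{\frac{1}{L\left(1+\sqrt{\frac{2(1-p)\omega}{pn}}\right)},\ \frac{p}{2\mu}\right\}.$$ R-MARINA starts from $x^0$ and $g_i^0=\nabla f_i(x^0)$. For $k=0,1,\dots$ it sets $g^k=\frac1n\sum_{i=1}^n g_i^k$ and $x^{k+1}=\mathrm{Exp}_{x^k}(-\gamma g^k)$, tosses one coin common to all workers, and puts, for all $i$, $$g_i^{k+1}=\nabla f_i(x^{k+1})\quad\text{with probability } p,$$ $$g_i^{k+1}=\Gamma_{x^k}^{x^{k+1}}g_i^k+\mathcal Q_i\left(\nabla f_i(x^{k+1})-\Gamma_{x^k}^{x^{k+1}}\nabla f_i(x^k)\right)\quad\text{with probability } 1-p,$$ where $\Gamma_{x^k}^{x^{k+1}}$ is parallel transport along the geodesic $t\mapsto\mathrm{Exp}_{x^k}(-t\gamma g^k)$,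 and the coin and the randomness of the $n$ compressors in iteration $k$ are independent of each other and of the past. Then for every $K\ge0$ the random variable $f(x^K)$ is integrable and $$\mathbb E\left[f(x^K)-f^*\right]\le(1-\gamma\mu)^K\left(f(x^0)-f^*\right).$$ If $x^*$ is a minimizer of $f$, then also $$\mathbb E\left[f(x^K)-f(x^*)\right]\le(1-\gamma\mu)^K\left(f(x^0)-f(x^*)\right).$$ -/

import Mathlib

open Bundle Set MeasureTheory ProbabilityTheory
open scoped Manifold ContDiff

noncomputable section

namespace RMarina

section Geometry

variable {d : ℕ} {M : Type*} [TopologicalSpace M] [ChartedSpace (EuclideanSpace ℝ (Fin d)) M]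
  [IsManifold (𝓡 d) ∞ M]
  [RiemannianBundle (fun x : M => TangentSpace (𝓡 d) x)]

/-- The coordinates, in the chart around `c`, of a tangent vector `v` at `x`. -/
def coord (c x : M) (v : TangentSpace (𝓡 d) x) : EuclideanSpace ℝ (Fin d) :=
  (trivializationAt (EuclideanSpace ℝ (Fin d)) (fun y : M => TangentSpace (𝓡 d) y)
    c).continuousLinearMapAt ℝ x v

/-- The metric `𝔤(a, b)` in the chart around `c`, at the point with coordinates `z`. -/
def chartMetric (c : M) (z a b : EuclideanSpace ℝ (Fin d)) : ℝ :=
  let x : M := (extChartAt (𝓡 d) c).symm z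
  let e := trivializationAt (EuclideanSpace ℝ (Fin d)) (fun y : M => TangentSpace (𝓡 d) y) c
  inner ℝ (e.symmL ℝ x a) (e.symmL ℝ x b)

/-- The Christoffel symbols of the first kind of the Levi-Civita connection in the chart around
`c`: `½ (∂ₐ 𝔤(b, w) + ∂_b 𝔤(a, w) - ∂_w 𝔤(a, b))`. -/
def christoffel (c : M) (z a b w : EuclideanSpace ℝ (Fin d)) : ℝ :=
  (fderiv ℝ (fun y => chartMetric c y b w) z a + fderiv ℝ (fun y => chartMetric c y a w) z b
    - fderiv ℝ (fun y => chartMetric c y a b) z w) / 2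

/-- The velocity of a curve. -/
def velocity (γ : ℝ → M) (t : ℝ) : TangentSpace (𝓡 d) (γ t) :=
  mfderiv 𝓘(ℝ, ℝ) (𝓡 d) γ t (1 : ℝ)

/-- The vector field `V` along `γ` is parallel (for the Levi-Civita connection) on the interval
`J`: in each chart, its coordinates satisfy `𝔤(V', w) + Γ(γ', V, w) = 0` for all `w`, which is the
equation `∇_{γ'} V = 0` with the index lowered. -/
def IsParallelOn (γ : ℝ → M) (V : (t : ℝ) → TangentSpace (𝓡 d) (γ t)) (J : Set ℝ) : Prop :=
  ∀ t ∈ J, ∀ c : M, γ t ∈ (chartAt (EuclideanSpace ℝ (Fin d)) c).source →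
    ∃ V' : EuclideanSpace ℝ (Fin d),
      HasDerivWithinAt (fun s => coord c (γ s) (V s)) V' J t ∧
      ∀ w : EuclideanSpace ℝ (Fin d),
        chartMetric c (extChartAt (𝓡 d) c (γ t)) V' w +
          christoffel c (extChartAt (𝓡 d) c (γ t)) (coord c (γ t) (velocity γ t))
            (coord c (γ t) (V t)) w = 0

variable (d) in
/-- A geodesic: a smooth curve whose velocity is parallel along it. -/
def IsGeodesic (γ : ℝ → M) : Prop :=
  ContMDiff 𝓘(ℝ, ℝ) (𝓡 d) ∞ γ ∧ IsParallelOn γ (velocity (d := d) γ) univ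

/-- The geodesic `γ` starts at `x` with velocity `v`. -/
def IsGeodesicFrom (x : M) (v : TangentSpace (𝓡 d) x) (γ : ℝ → M) : Prop :=
  IsGeodesic d γ ∧
    (⟨γ 0, velocity γ 0⟩ : TangentBundle (𝓡 d) M) = (⟨x, v⟩ : TangentBundle (𝓡 d) M)

variable (d M) in
/-- Every initial condition is that of a geodesic defined for all times: the exponential map is
defined on the whole tangent bundle. -/
def GeodesicallyComplete : Prop :=
  ∀ (x : M) (v : TangentSpace (𝓡 d) x), ∃ γ : ℝ → M, IsGeodesicFrom x v γ

open Classical in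
/-- The geodesic `t ↦ Exp_x(t v)` (a constant curve if there is none). -/
def geodesic (x : M) (v : TangentSpace (𝓡 d) x) : ℝ → M :=
  if h : ∃ γ : ℝ → M, IsGeodesicFrom x v γ then h.choose else fun _ => x

/-- The exponential map `Exp_x(v)`. -/
def expMap (x : M) (v : TangentSpace (𝓡 d) x) : M := geodesic x v 1

open Classical in
/-- Parallel transport of a vector `w` at `x = γ 0` along `γ|_[0,1]` to the tangent space at
`γ 1`. -/
def transport (γ : ℝ → M) (x : M) (w : TangentSpace (𝓡 d) x) : TangentSpace (𝓡 d) (γ 1) :=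
  if h : ∃ V : (t : ℝ) → TangentSpace (𝓡 d) (γ t), IsParallelOn γ V (Icc 0 1) ∧
      (⟨γ 0, V 0⟩ : TangentBundle (𝓡 d) M) = (⟨x, w⟩ : TangentBundle (𝓡 d) M)
  then h.choose 1 else 0

/-- Parallel transport `Γ_x^y w` from `x` to `y = Exp_x(v)`, along the geodesic `t ↦ Exp_x(t v)`. -/
def expTransport (x : M) (v w : TangentSpace (𝓡 d) x) : TangentSpace (𝓡 d) (expMap x v) :=
  transport (geodesic x v) x w

/-- The Riemannian gradient: `⟨∇f(x), v⟩ = df_x(v)` for all `v`. -/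
def grad (f : M → ℝ) (x : M) : TangentSpace (𝓡 d) x :=
  haveI : FiniteDimensional ℝ (TangentSpace (𝓡 d) x) :=
    inferInstanceAs (FiniteDimensional ℝ (EuclideanSpace ℝ (Fin d)))
  haveI : CompleteSpace (TangentSpace (𝓡 d) x) := FiniteDimensional.complete ℝ _
  (InnerProductSpace.toDual ℝ (TangentSpace (𝓡 d) x)).symm (mfderiv (𝓡 d) 𝓘(ℝ, ℝ) f x)

/-- `f` is differentiable and its gradient is geodesically `L`-Lipschitz: for each geodesic `γ`
from `y = γ 0` to `x = γ 1`, `‖∇f(x) - Γ_y^x ∇f(y)‖ ≤ L ‖γ'(0)‖`, where `γ'(0) = Exp_y⁻¹(x)` when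
geodesics are unique. -/
def GSmooth (L : ℝ) (f : M → ℝ) : Prop :=
  MDifferentiable (𝓡 d) 𝓘(ℝ, ℝ) f ∧
    ∀ γ : ℝ → M, IsGeodesic d γ →
      ‖grad (d := d) f (γ 1) - transport γ (γ 0) (grad f (γ 0))‖ ≤ L * ‖velocity (d := d) γ 0‖

variable (d) in
/-- The Polyak-Łojasiewicz condition with constant `μ` and lower bound `fstar`. -/
def PLCondition (μ fstar : ℝ) (f : M → ℝ) : Prop :=
  (∀ x, fstar ≤ f x) ∧ ∀ x, 2 * μ * (f x - fstar) ≤ ‖grad (d := d) f x‖ ^ 2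

end Geometry

/-- The average `f = (1/n) ∑ fᵢ`. -/
def average {M : Type*} {n : ℕ} (f : Fin n → M → ℝ) (x : M) : ℝ := (n : ℝ)⁻¹ * ∑ i, f i x

/-- The tangent bundle carries its Borel σ-algebra. -/
instance tangentBundleMeasurableSpace {d : ℕ} {M : Type*} [TopologicalSpace M] [ChartedSpace (EuclideanSpace ℝ (Fin d)) M]
    [IsManifold (𝓡 d) ∞ M] : MeasurableSpace (TangentBundle (𝓡 d) M) := borel _

section Algorithm

variable {d n : ℕ} {M : Type*} [TopologicalSpace M] [ChartedSpace (EuclideanSpace ℝ (Fin d)) M]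
  [IsManifold (𝓡 d) ∞ M]
  [RiemannianBundle (fun x : M => TangentSpace (𝓡 d) x)]
  {S : Type*} [MeasurableSpace S]

/-- A stochastic mapping `T_xM → T_xM`, for all `x`, driven by a random seed `s` with law `ν`, is
an unbiased compressor with conic variance parameter `omega`. -/
structure IsUnbiasedCompressor (ν : Measure S) (omega : ℝ)
    (Q : (x : M) → S → TangentSpace (𝓡 d) x → TangentSpace (𝓡 d) x) : Prop where
  measurable : Measurable (fun q : S × TangentBundle (𝓡 d) M =>
    (⟨q.2.1, Q q.2.1 q.1 q.2.2⟩ : TangentBundle (𝓡 d) M))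
  integrable : ∀ (x : M) (y : TangentSpace (𝓡 d) x), Integrable (fun s => Q x s y) ν
  unbiased : ∀ (x : M) (y : TangentSpace (𝓡 d) x), ∫ s, Q x s y ∂ν = y
  integrable_sq : ∀ (x : M) (y : TangentSpace (𝓡 d) x),
    Integrable (fun s => ‖Q x s y - y‖ ^ 2) ν
  variance_le : ∀ (x : M) (y : TangentSpace (𝓡 d) x),
    ∫ s, ‖Q x s y - y‖ ^ 2 ∂ν ≤ omega * ‖y‖ ^ 2

variable (d n M) in
/-- The state of the method after `k` iterations: the point `xᵏ` and the vectors `gᵢᵏ ∈ T_{xᵏ}M`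
held by the `n` workers. -/
structure State where
  point : M
  vec : Fin n → TangentSpace (𝓡 d) point

namespace State

/-- `gᵏ = (1/n) ∑ gᵢᵏ`. -/
def mean (σ : State d n M) : TangentSpace (𝓡 d) σ.point := (n : ℝ)⁻¹ • ∑ i, σ.vec i

/-- `xᵏ⁺¹ = Exp_{xᵏ}(-η gᵏ)`. -/
def next (η : ℝ) (σ : State d n M) : M := expMap σ.point (-(η • σ.mean))

/-- Parallel transport `Γ_{xᵏ}^{xᵏ⁺¹} w`. -/
def move (η : ℝ) (σ : State d n M) (w : TangentSpace (𝓡 d) σ.point) :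
    TangentSpace (𝓡 d) (σ.next η) := expTransport σ.point (-(η • σ.mean)) w

/-- The gradient difference `∇fᵢ(xᵏ⁺¹) - Γ_{xᵏ}^{xᵏ⁺¹} ∇fᵢ(xᵏ)`. -/
def diff (f : Fin n → M → ℝ) (η : ℝ) (σ : State d n M) (i : Fin n) :
    TangentSpace (𝓡 d) (σ.next η) := grad (f i) (σ.next η) - σ.move η (grad (f i) σ.point)

/-- One iteration. The coin is common to all workers; `s i` is the seed of the compressor of the
`i`-th worker. -/
def step (f : Fin n → M → ℝ)
    (Q : Fin n → (x : M) → S → TangentSpace (𝓡 d) x → TangentSpace (𝓡 d) x) (η : ℝ)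
    (coin : Bool) (s : Fin n → S) (σ : State d n M) : State d n M where
  point := σ.next η
  vec := fun i =>
    if coin then grad (f i) (σ.next η)
    else σ.move η (σ.vec i) + Q i (σ.next η) (s i) (σ.diff f η i)

end State

/-- R-MARINA started at `x₀`, with `gᵢ⁰ = ∇fᵢ(x₀)`; iteration `k` uses the coin `(z k).1` and the
seeds `(z k).2`. -/
def run (f : Fin n → M → ℝ)
    (Q : Fin n → (x : M) → S → TangentSpace (𝓡 d) x → TangentSpace (𝓡 d) x) (η : ℝ) (x₀ : M)
    (z : ℕ → Bool × (Fin n → S)) : ℕ → State d n M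
  | 0 => ⟨x₀, fun i => grad (f i) x₀⟩
  | k + 1 => (run f Q η x₀ z k).step f Q η (z k).1 (z k).2

/-- The random iterate `xᵏ`, as a function of the outcome `a`. -/
def iterate {Ω : Type*} (f : Fin n → M → ℝ)
    (Q : Fin n → (x : M) → S → TangentSpace (𝓡 d) x → TangentSpace (𝓡 d) x) (η : ℝ) (x₀ : M)
    (Z : ℕ → Ω → Bool × (Fin n → S)) (k : ℕ) (a : Ω) : M :=
  (run f Q η x₀ (fun j => Z j a) k).point

/-- The law of the randomness of one iteration: a coin showing `true` with probability `p`, and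
`n` seeds with law `ν`, all independent. -/
def stepLaw (n : ℕ) (p : ℝ) (ν : Measure S) : Measure (Bool × (Fin n → S)) :=
  (ENNReal.ofReal p • Measure.dirac true + ENNReal.ofReal (1 - p) • Measure.dirac false).prod
    (Measure.pi fun _ => ν)

/-- All the vectors that occur in the run `σ` before the coin and the seeds of iteration `k` are
drawn are random vectors determined by the past `ℱ k`. -/
def Adapted {Ω : Type*} [mΩ : MeasurableSpace Ω] (ℱ : Filtration ℕ mΩ) (f : Fin n → M → ℝ) (η : ℝ)
    (σ : ℕ → Ω → State d n M) : Prop :=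
  ∀ (k : ℕ) (i : Fin n),
    Measurable[ℱ k] (fun a => (⟨(σ k a).point, (σ k a).vec i⟩ : TangentBundle (𝓡 d) M)) ∧
    Measurable[ℱ k]
      (fun a => (⟨(σ k a).point, grad (f i) (σ k a).point⟩ : TangentBundle (𝓡 d) M)) ∧
    Measurable[ℱ k]
      (fun a => (⟨(σ k a).next η, (σ k a).move η ((σ k a).vec i)⟩ : TangentBundle (𝓡 d) M)) ∧
    Measurable[ℱ k]
      (fun a => (⟨(σ k a).next η, (σ k a).diff f η i⟩ : TangentBundle (𝓡 d) M))

end Algorithm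

end RMarina

end

/-!
In a chart, parallel transport solves a linear ordinary differential equation, so it exists, and
metric compatibility makes it a linear isometry. Integrating `d/dt f(c(t)) = ⟨∇f(c(t)), c'(t)⟩`
along a geodesic `c`, whose velocity is parallel, therefore turns geodesic smoothness into the
descent inequality `f(Exp_x v) ≤ f(x) + ⟨∇f(x), v⟩ + (L / 2) ‖v‖²`.

The Lyapunov function is `Φᵏ = f(xᵏ) - f* + (γ / p) ‖gᵏ - ∇f(xᵏ)‖²`. The error `gᵏ⁺¹ - ∇f(xᵏ⁺¹)`
vanishes with probability `p`; otherwise it is the isometric image of `gᵏ - ∇f(xᵏ)` plus an average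
of `n` independent centred compression errors, whose variance is at most `(ω / n) (L γ)² ‖gᵏ‖²`. The
descent inequality leaves a negative multiple of `‖gᵏ‖²` that absorbs this variance for the given
stepsize, and the Polyak-Łojasiewicz condition yields `E[Φᵏ⁺¹] ≤ (1 - γ μ) E[Φᵏ]`,
where `Φ⁰ = f(x⁰) - f*` since `g⁰ = ∇f(x⁰)`. At a minimizer the descent inequality forces the
gradient to vanish, so its value is `f*`.
-/

noncomputable section

namespace RMarina

set_option maxSynthPendingDepth 3

variable {d : ℕ} {M : Type*} [TopologicalSpace M] [ChartedSpace (EuclideanSpace ℝ (Fin d)) M]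

local notation "𝔼" => EuclideanSpace ℝ (Fin d)

section Charts

lemma extChartAt_mem_target {c x : M} (hx : x ∈ (chartAt 𝔼 c).source) :
    extChartAt (𝓡 d) c x ∈ (extChartAt (𝓡 d) c).target :=
  (extChartAt (𝓡 d) c).map_source (by rwa [extChartAt_source])

lemma extChartAt_symm_extChartAt {c x : M} (hx : x ∈ (chartAt 𝔼 c).source) :
    (extChartAt (𝓡 d) c).symm (extChartAt (𝓡 d) c x) = x :=
  (extChartAt (𝓡 d) c).left_inv (by rwa [extChartAt_source])

lemma extChartAt_symm_mem_source {c : M} {z : 𝔼} (hz : z ∈ (extChartAt (𝓡 d) c).target) :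
    (extChartAt (𝓡 d) c).symm z ∈ (chartAt 𝔼 c).source := by
  simpa only [extChartAt_source] using (extChartAt (𝓡 d) c).map_target hz

/-- The transition map between the charts around `c` and `c'`. -/
def transition (c c' : M) : 𝔼 → 𝔼 := extChartAt (𝓡 d) c' ∘ (extChartAt (𝓡 d) c).symm

/-- The domain of the transition map. -/
def overlap (c c' : M) : Set 𝔼 :=
  (extChartAt (𝓡 d) c).target ∩ (extChartAt (𝓡 d) c).symm ⁻¹' (chartAt 𝔼 c').source

lemma isOpen_overlap (c c' : M) : IsOpen (overlap (d := d) c c') :=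
  (continuousOn_extChartAt_symm c).isOpen_inter_preimage (isOpen_extChartAt_target c)
    (chartAt 𝔼 c').open_source

lemma extChartAt_mem_overlap {c c' x : M} (hx : x ∈ (chartAt 𝔼 c).source)
    (hx' : x ∈ (chartAt 𝔼 c').source) : extChartAt (𝓡 d) c x ∈ overlap c c' :=
  ⟨extChartAt_mem_target hx, by rwa [mem_preimage, extChartAt_symm_extChartAt hx]⟩

lemma transition_extChartAt {c x : M} (hx : x ∈ (chartAt 𝔼 c).source) (c' : M) :
    transition c c' (extChartAt (𝓡 d) c x) = extChartAt (𝓡 d) c' x := by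
  rw [transition, Function.comp_apply, extChartAt_symm_extChartAt hx]

variable [IsManifold (𝓡 d) ∞ M]

lemma contDiffOn_transition (c c' : M) :
    ContDiffOn ℝ ∞ (transition (d := d) c c') (overlap c c') := by
  have hsymm : ContMDiffOn 𝓘(ℝ, 𝔼) (𝓡 d) ∞ (extChartAt (𝓡 d) c).symm
      (extChartAt (𝓡 d) c).target := contMDiffOn_extChartAt_symm c
  have hchart : ContMDiffOn (𝓡 d) 𝓘(ℝ, 𝔼) ∞ (extChartAt (𝓡 d) c') (chartAt 𝔼 c').source :=
    contMDiffOn_extChartAt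
  exact contMDiffOn_iff_contDiffOn.1 (hchart.comp (hsymm.mono inter_subset_left) inter_subset_right)

lemma contDiffAt_transition {c c' : M} {z : 𝔼} (hz : z ∈ overlap c c') :
    ContDiffAt ℝ ∞ (transition c c') z :=
  (contDiffOn_transition c c').contDiffAt ((isOpen_overlap c c').mem_nhds hz)

end Charts

section Coordinates

variable [IsManifold (𝓡 d) ∞ M]

lemma coord_add (c x : M) (v w : TangentSpace (𝓡 d) x) :
    coord c x (v + w) = coord c x v + coord c x w := map_add _ _ _

lemma coord_sub (c x : M) (v w : TangentSpace (𝓡 d) x) :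
    coord c x (v - w) = coord c x v - coord c x w := map_sub _ _ _

lemma coord_smul (c x : M) (r : ℝ) (v : TangentSpace (𝓡 d) x) :
    coord c x (r • v) = r • coord c x v := map_smul _ _ _

lemma coord_sum (c x : M) {ι : Type*} (s : Finset ι) (v : ι → TangentSpace (𝓡 d) x) :
    coord c x (∑ i ∈ s, v i) = ∑ i ∈ s, coord c x (v i) := map_sum _ _ _

/-- The tangent vector at `x` with coordinates `a` in the chart around `c`: the inverse of
`coord c x` when `x` lies in that chart. -/
def uncoord (c x : M) (a : 𝔼) : TangentSpace (𝓡 d) x :=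
  (trivializationAt 𝔼 (fun y : M => TangentSpace (𝓡 d) y) c).symmL ℝ x a

lemma uncoord_coord {c x : M} (hx : x ∈ (chartAt 𝔼 c).source) (v : TangentSpace (𝓡 d) x) :
    uncoord c x (coord c x v) = v :=
  (trivializationAt 𝔼 (fun y : M => TangentSpace (𝓡 d) y) c).symmL_continuousLinearMapAt
    (R := ℝ) hx v

lemma coord_uncoord {c x : M} (hx : x ∈ (chartAt 𝔼 c).source) (a : 𝔼) :
    coord c x (uncoord c x a) = a :=
  (trivializationAt 𝔼 (fun y : M => TangentSpace (𝓡 d) y) c).continuousLinearMapAt_symmL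
    (R := ℝ) hx a

lemma coord_eq_mfderiv_extChartAt {c x : M} (hx : x ∈ (chartAt 𝔼 c).source)
    (v : TangentSpace (𝓡 d) x) :
    coord c x v = mfderiv (𝓡 d) 𝓘(ℝ, 𝔼) (extChartAt (𝓡 d) c) x v := by
  rw [coord, TangentBundle.continuousLinearMapAt_trivializationAt hx]
  rfl

lemma differentiableAt_comp_extChartAt_symm {F : Type*} [NormedAddCommGroup F] [NormedSpace ℝ F]
    {f : M → F} {c : M} {z : 𝔼} (hz : z ∈ (extChartAt (𝓡 d) c).target)
    (hf : MDifferentiableAt (𝓡 d) 𝓘(ℝ, F) f ((extChartAt (𝓡 d) c).symm z)) :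
    DifferentiableAt ℝ (f ∘ (extChartAt (𝓡 d) c).symm) z :=
  (hf.comp z (((contMDiffOn_extChartAt_symm (n := ∞) c).contMDiffAt
    ((isOpen_extChartAt_target c).mem_nhds hz)).mdifferentiableAt (by simp))).differentiableAt

lemma mfderiv_eq_fderiv_comp_extChartAt_symm {F : Type*} [NormedAddCommGroup F] [NormedSpace ℝ F]
    {f : M → F} {c x : M} (hx : x ∈ (chartAt 𝔼 c).source)
    (hf : MDifferentiableAt (𝓡 d) 𝓘(ℝ, F) f x) (v : TangentSpace (𝓡 d) x) :
    mfderiv (𝓡 d) 𝓘(ℝ, F) f x v =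
      fderiv ℝ (f ∘ (extChartAt (𝓡 d) c).symm) (extChartAt (𝓡 d) c x) (coord c x v) := by
  have hchart : MDifferentiableAt (𝓡 d) 𝓘(ℝ, 𝔼) (extChartAt (𝓡 d) c) x :=
    mdifferentiableAt_extChartAt hx
  have hf' : DifferentiableAt ℝ (f ∘ (extChartAt (𝓡 d) c).symm) (extChartAt (𝓡 d) c x) :=
    differentiableAt_comp_extChartAt_symm (extChartAt_mem_target hx)
      (by rwa [extChartAt_symm_extChartAt hx])
  have heq : (f ∘ (extChartAt (𝓡 d) c).symm) ∘ extChartAt (𝓡 d) c =ᶠ[nhds x] f := by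
    filter_upwards [(chartAt 𝔼 c).open_source.mem_nhds hx] with y hy
    simp only [Function.comp_apply, extChartAt_symm_extChartAt hy]
  rw [coord_eq_mfderiv_extChartAt hx, ← heq.mfderiv_eq,
    (hf'.hasFDerivAt.hasMFDerivAt.comp x hchart.hasMFDerivAt).mfderiv]
  rfl

lemma coord_eq_fderiv_transition {c c' x : M} (hx : x ∈ (chartAt 𝔼 c).source)
    (hx' : x ∈ (chartAt 𝔼 c').source) (v : TangentSpace (𝓡 d) x) :
    coord c' x v = fderiv ℝ (transition c c') (extChartAt (𝓡 d) c x) (coord c x v) := by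
  rw [coord_eq_mfderiv_extChartAt hx',
    mfderiv_eq_fderiv_comp_extChartAt_symm hx (mdifferentiableAt_extChartAt hx')]
  rfl

lemma hasDerivAt_extChartAt_comp {γ : ℝ → M} {t : ℝ}
    (hγ : MDifferentiableAt 𝓘(ℝ, ℝ) (𝓡 d) γ t) {c : M} (hx : γ t ∈ (chartAt 𝔼 c).source) :
    HasDerivAt (fun s => extChartAt (𝓡 d) c (γ s)) (coord c (γ t) (velocity γ t)) t := by
  have hchart : MDifferentiableAt (𝓡 d) 𝓘(ℝ, 𝔼) (extChartAt (𝓡 d) c) (γ t) :=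
    mdifferentiableAt_extChartAt hx
  let D : ℝ →L[ℝ] 𝔼 := (mfderiv (𝓡 d) 𝓘(ℝ, 𝔼) (extChartAt (𝓡 d) c) (γ t)).comp
    (mfderiv 𝓘(ℝ, ℝ) (𝓡 d) γ t)
  have hcomp : HasFDerivAt (fun s => extChartAt (𝓡 d) c (γ s)) D t :=
    (hchart.hasMFDerivAt.comp t hγ.hasMFDerivAt).hasFDerivAt
  rw [coord_eq_mfderiv_extChartAt hx]
  exact hcomp.hasDerivAt

end Coordinates

section KoszulForm

variable {V : Type*} [NormedAddCommGroup V] [NormedSpace ℝ V]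

/-- The Christoffel symbols of the first kind, `koszulForm D a b w = ½ (∂ₐ g(b, w) + ∂_b g(a, w) -
∂_w g(a, b))`, of a metric `g` whose derivative is `D`. -/
def koszulForm (D : V →L[ℝ] V →L[ℝ] V →L[ℝ] ℝ) (a : V) : V →L[ℝ] V →L[ℝ] ℝ :=
  (2⁻¹ : ℝ) • (D a + D.flip a - (D.flip a).flip)

lemma koszulForm_apply (D : V →L[ℝ] V →L[ℝ] V →L[ℝ] ℝ) (a b w : V) :
    koszulForm D a b w = (D a b w + D b a w - D w a b) / 2 := by
  simp only [koszulForm, smul_apply, sub_apply, add_apply, ContinuousLinearMap.flip_apply,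
    smul_eq_mul]
  ring

lemma continuous_koszulForm :
    Continuous fun q : (V →L[ℝ] V →L[ℝ] V →L[ℝ] ℝ) × V => koszulForm q.1 q.2 := by
  have hflip : Continuous fun q : (V →L[ℝ] V →L[ℝ] V →L[ℝ] ℝ) × V => q.1.flip q.2 :=
    ((ContinuousLinearMap.flipₗᵢ ℝ V V (V →L[ℝ] ℝ)).continuous.comp continuous_fst).clm_apply
      continuous_snd
  exact (((continuous_fst.clm_apply continuous_snd).add hflip).sub
    ((ContinuousLinearMap.flipₗᵢ ℝ V V ℝ).continuous.comp hflip)).const_smul (2⁻¹ : ℝ)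

lemma fderiv_bilinear_apply {G : V → V →L[ℝ] V →L[ℝ] ℝ} {z : V} (hG : DifferentiableAt ℝ G z)
    (a b w : V) : fderiv ℝ (fun y => G y a b) z w = fderiv ℝ G z w a b := by
  rw [((hG.hasFDerivAt.clm_apply (hasFDerivAt_const a z)).clm_apply
    (hasFDerivAt_const b z)).fderiv]
  simp

lemma hasFDerivAt_fderiv {φ : V → V} {z : V} (hφ : ContDiffAt ℝ 2 φ z) :
    HasFDerivAt (fderiv ℝ φ) (fderiv ℝ (fderiv ℝ φ) z) z :=
  ((hφ.fderiv_right (m := 1) (by norm_num)).differentiableAt (by simp)).hasFDerivAt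

lemma hasDerivWithinAt_fderiv_apply {φ : V → V} {u v : ℝ → V} {u' v' : V} {J : Set ℝ} {t : ℝ}
    (hφ : ContDiffAt ℝ 2 φ (u t)) (hu : HasDerivAt u u' t) (hv : HasDerivWithinAt v v' J t) :
    HasDerivWithinAt (fun s => fderiv ℝ φ (u s) (v s))
      (fderiv ℝ (fderiv ℝ φ) (u t) u' (v t) + fderiv ℝ φ (u t) v') J t :=
  ((hasFDerivAt_fderiv hφ).comp_hasDerivWithinAt t hu.hasDerivWithinAt).clm_apply hv

lemma hasDerivWithinAt_bilinear_apply {G : V → V →L[ℝ] V →L[ℝ] ℝ} {u a b : ℝ → V}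
    {u' a' b' : V} {J : Set ℝ} {t : ℝ} (hG : DifferentiableAt ℝ G (u t))
    (hu : HasDerivAt u u' t) (ha : HasDerivWithinAt a a' J t) (hb : HasDerivWithinAt b b' J t) :
    HasDerivWithinAt (fun s => G (u s) (a s) (b s))
      (fderiv ℝ G (u t) u' (a t) (b t) + G (u t) a' (b t) + G (u t) (a t) b') J t := by
  simpa using
    ((hG.hasFDerivAt.comp_hasDerivWithinAt t hu.hasDerivWithinAt).clm_apply ha).clm_apply hb

lemma fderiv_pullback_apply {G G' : V → V →L[ℝ] V →L[ℝ] ℝ} {φ : V → V} {z : V}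
    (hG : DifferentiableAt ℝ G z) (hG' : DifferentiableAt ℝ G' (φ z)) (hφ : ContDiffAt ℝ 2 φ z)
    (h : ∀ᶠ y in nhds z, ∀ a b, G y a b = G' (φ y) (fderiv ℝ φ y a) (fderiv ℝ φ y b))
    (e a b : V) :
    fderiv ℝ G z e a b =
      fderiv ℝ G' (φ z) (fderiv ℝ φ z e) (fderiv ℝ φ z a) (fderiv ℝ φ z b)
        + G' (φ z) (fderiv ℝ (fderiv ℝ φ) z e a) (fderiv ℝ φ z b)
        + G' (φ z) (fderiv ℝ φ z a) (fderiv ℝ (fderiv ℝ φ) z e b) := by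
  have hφ₁ : HasFDerivAt φ (fderiv ℝ φ z) z := (hφ.differentiableAt (by simp)).hasFDerivAt
  have hφ₂ := hasFDerivAt_fderiv hφ
  have hpull := ((hG'.hasFDerivAt.comp z hφ₁).clm_apply
    (hφ₂.clm_apply (hasFDerivAt_const a z))).clm_apply (hφ₂.clm_apply (hasFDerivAt_const b z))
  have heq : (fun y => G y a b) =ᶠ[nhds z]
      fun y => (G' ∘ φ) y (fderiv ℝ φ y a) (fderiv ℝ φ y b) := h.mono fun y hy => hy a b
  rw [← fderiv_bilinear_apply hG, heq.fderiv_eq, hpull.fderiv]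
  simp only [Function.comp_apply, ContinuousLinearMap.comp_zero, zero_add,
    ContinuousLinearMap.flip_add, add_apply, ContinuousLinearMap.comp_apply,
    ContinuousLinearMap.flip_apply]
  ring

/-- The second derivative of `φ` enters through the symmetric bilinear map `D²φ`, all of whose
contributions but one cancel in the Koszul formula. -/
lemma koszulForm_pullback {G G' : V → V →L[ℝ] V →L[ℝ] ℝ} {φ : V → V} {z : V}
    (hG : DifferentiableAt ℝ G z) (hG' : DifferentiableAt ℝ G' (φ z)) (hφ : ContDiffAt ℝ 2 φ z)
    (h : ∀ᶠ y in nhds z, ∀ a b, G y a b = G' (φ y) (fderiv ℝ φ y a) (fderiv ℝ φ y b))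
    (hsymm : ∀ a b, G' (φ z) a b = G' (φ z) b a) (a b w : V) :
    koszulForm (fderiv ℝ G z) a b w =
      koszulForm (fderiv ℝ G' (φ z)) (fderiv ℝ φ z a) (fderiv ℝ φ z b) (fderiv ℝ φ z w)
        + G' (φ z) (fderiv ℝ (fderiv ℝ φ) z a b) (fderiv ℝ φ z w) := by
  have hD₂ : ∀ a b, fderiv ℝ (fderiv ℝ φ) z a b = fderiv ℝ (fderiv ℝ φ) z b a :=
    fun a b => (hφ.isSymmSndFDerivAt (by simp)).eq a b
  simp only [koszulForm_apply, fderiv_pullback_apply hG hG' hφ h]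
  rw [hD₂ b a, hD₂ w a, hD₂ w b, hsymm (fderiv ℝ φ z b) (fderiv ℝ (fderiv ℝ φ) z a w)]
  ring

end KoszulForm

section ChartMetric

variable [IsManifold (𝓡 d) ∞ M] [RiemannianBundle (fun x : M => TangentSpace (𝓡 d) x)]

lemma inner_eq_chartMetric {c x : M} (hx : x ∈ (chartAt 𝔼 c).source)
    (v w : TangentSpace (𝓡 d) x) :
    inner ℝ v w = chartMetric c (extChartAt (𝓡 d) c x) (coord c x v) (coord c x w) := by
  have h : ∀ y : M, y = x → inner ℝ v w =
      inner ℝ (uncoord c y (coord c x v)) (uncoord c y (coord c x w)) := by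
    rintro y rfl
    rw [uncoord_coord hx, uncoord_coord hx]
  exact h _ (extChartAt_symm_extChartAt hx)

/-- The metric in the chart around `c`, as a continuous bilinear form. -/
def metricForm (c : M) (z : 𝔼) : 𝔼 →L[ℝ] 𝔼 →L[ℝ] ℝ :=
  LinearMap.toContinuousLinearMap
    (LinearMap.toContinuousLinearMap.toLinearMap ∘ₗ
      (LinearMap.mk₂ ℝ (chartMetric c z)
        (fun a b _ => (congrArg₂ _ (map_add _ a b) rfl).trans (inner_add_left _ _ _))
        (fun r a _ => (congrArg₂ _ (map_smul _ r a) rfl).trans (real_inner_smul_left _ _ _))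
        (fun _ b w => (congrArg₂ _ rfl (map_add _ b w)).trans (inner_add_right _ _ _))
        (fun r _ b => (congrArg₂ _ rfl (map_smul _ r b)).trans (real_inner_smul_right _ _ _))))

lemma metricForm_apply (c : M) (z a b : 𝔼) : metricForm c z a b = chartMetric c z a b := rfl

lemma metricForm_symm (c : M) (z a b : 𝔼) : metricForm c z a b = metricForm c z b a := by
  simp only [metricForm_apply, chartMetric]
  exact real_inner_comm _ _

lemma eq_zero_of_metricForm_self_eq_zero {c : M} {z : 𝔼}
    (hz : z ∈ (extChartAt (𝓡 d) c).target) {a : 𝔼} (ha : metricForm c z a a = 0) : a = 0 := by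
  have h : uncoord c ((extChartAt (𝓡 d) c).symm z) a = 0 := inner_self_eq_zero (𝕜 := ℝ).1 ha
  rw [← coord_uncoord (extChartAt_symm_mem_source hz) a, h]
  exact map_zero _

lemma isInvertible_metricForm {c : M} {z : 𝔼} (hz : z ∈ (extChartAt (𝓡 d) c).target) :
    (metricForm c z).IsInvertible := by
  have hinj : Function.Injective (metricForm c z).toLinearMap :=
    LinearMap.ker_eq_bot.1 <| LinearMap.ker_eq_bot'.2 fun a ha =>
      eq_zero_of_metricForm_self_eq_zero hz (DFunLike.congr_fun (F := 𝔼 →L[ℝ] ℝ) ha a)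
  have hfin : Module.finrank ℝ 𝔼 = Module.finrank ℝ (𝔼 →L[ℝ] ℝ) :=
    LinearEquiv.finrank_eq (InnerProductSpace.toDual ℝ 𝔼).toLinearEquiv
  exact ⟨(LinearEquiv.ofInjectiveOfFinrankEq _ hinj hfin).toContinuousLinearEquiv, rfl⟩

lemma metricForm_transition {c c' : M} {y : 𝔼} (hy : y ∈ overlap c c') (a b : 𝔼) :
    metricForm c y a b = metricForm c' (transition c c' y) (fderiv ℝ (transition c c') y a)
      (fderiv ℝ (transition c c') y b) := by
  set x := (extChartAt (𝓡 d) c).symm y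
  have hxs : x ∈ (chartAt 𝔼 c).source := extChartAt_symm_mem_source hy.1
  have hxy : extChartAt (𝓡 d) c x = y := (extChartAt (𝓡 d) c).right_inv hy.1
  have hfderiv : ∀ a : 𝔼, fderiv ℝ (transition c c') y a = coord c' x (uncoord c x a) :=
    fun a => by rw [coord_eq_fderiv_transition hxs hy.2, hxy, coord_uncoord hxs]
  rw [hfderiv, hfderiv]
  exact inner_eq_chartMetric hy.2 (uncoord c x a) (uncoord c x b)

end ChartMetric

section SmoothMetric

variable [IsManifold (𝓡 d) ∞ M]

lemma contMDiffOn_uncoord (c : M) (a : 𝔼) :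
    ContMDiffOn (𝓡 d) ((𝓡 d).prod 𝓘(ℝ, 𝔼)) ∞
      (fun x : M => (⟨x, uncoord c x a⟩ : TotalSpace 𝔼 (fun y : M => TangentSpace (𝓡 d) y)))
      (chartAt 𝔼 c).source := by
  set e := trivializationAt 𝔼 (fun y : M => TangentSpace (𝓡 d) y) c
  refine ((e.contMDiffOn_symm (IB := 𝓡 d) (n := ∞)).comp
    (contMDiff_id.prodMk (contMDiff_const (c := a))).contMDiffOn ?_).congr ?_
  · exact fun x hx => e.mem_target.2 hx
  · intro x hx
    simp only [Function.comp_apply, id_eq, uncoord]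
    rw [← e.mk_symm hx, e.symmL_apply hx]

variable [RiemannianBundle (fun x : M => TangentSpace (𝓡 d) x)]
  [IsContMDiffRiemannianBundle (𝓡 d) ∞ (EuclideanSpace ℝ (Fin d))
    (fun x : M => TangentSpace (𝓡 d) x)]

lemma contDiffOn_chartMetric (c : M) (a b : 𝔼) :
    ContDiffOn ℝ ∞ (fun z => chartMetric c z a b) (extChartAt (𝓡 d) c).target :=
  contMDiffOn_iff_contDiffOn.1 <|
    ((contMDiffOn_uncoord c a).inner_bundle (contMDiffOn_uncoord c b)).comp
      (contMDiffOn_extChartAt_symm c) fun _ hz => extChartAt_symm_mem_source hz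

lemma contDiffAt_metricForm {c : M} {z : 𝔼} (hz : z ∈ (extChartAt (𝓡 d) c).target) :
    ContDiffAt ℝ ∞ (metricForm (d := d) c) z := by
  have h : ContDiffOn ℝ ∞ (metricForm (d := d) c) (extChartAt (𝓡 d) c).target :=
    contDiffOn_clm_apply.2 fun a => contDiffOn_clm_apply.2 fun b => contDiffOn_chartMetric c a b
  exact h.contDiffAt ((isOpen_extChartAt_target c).mem_nhds hz)

lemma differentiableAt_metricForm {c : M} {z : 𝔼} (hz : z ∈ (extChartAt (𝓡 d) c).target) :
    DifferentiableAt ℝ (metricForm (d := d) c) z :=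
  (contDiffAt_metricForm hz).differentiableAt (by simp)

lemma fderiv_chartMetric {c : M} {z : 𝔼} (hz : z ∈ (extChartAt (𝓡 d) c).target) (a b w : 𝔼) :
    fderiv ℝ (fun y => chartMetric c y a b) z w = fderiv ℝ (metricForm c) z w a b :=
  fderiv_bilinear_apply (differentiableAt_metricForm hz) a b w

lemma christoffel_eq_koszulForm {c : M} {z : 𝔼} (hz : z ∈ (extChartAt (𝓡 d) c).target)
    (a b w : 𝔼) : christoffel c z a b w = koszulForm (fderiv ℝ (metricForm c) z) a b w := by
  simp only [christoffel, fderiv_chartMetric hz, koszulForm_apply]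

/-- Metric compatibility of the Levi-Civita connection. -/
lemma christoffel_add_christoffel_swap {c : M} {z : 𝔼} (hz : z ∈ (extChartAt (𝓡 d) c).target)
    (a b w : 𝔼) :
    christoffel c z a b w + christoffel c z a w b = fderiv ℝ (metricForm c) z a b w := by
  have hsymm : fderiv ℝ (metricForm c) z a w b = fderiv ℝ (metricForm c) z a b w := by
    have hswap : (fun y => chartMetric c y w b) = fun y => chartMetric c y b w :=
      funext fun y => metricForm_symm c y w b
    rw [← fderiv_chartMetric hz, ← fderiv_chartMetric hz, hswap]
  simp only [christoffel, fderiv_chartMetric hz, hsymm]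
  ring

lemma christoffel_transition {c c' : M} {y : 𝔼} (hy : y ∈ overlap c c') (a b w : 𝔼) :
    christoffel c y a b w = christoffel c' (transition c c' y)
      (fderiv ℝ (transition c c') y a) (fderiv ℝ (transition c c') y b)
      (fderiv ℝ (transition c c') y w) + metricForm c' (transition c c' y)
        (fderiv ℝ (fderiv ℝ (transition c c')) y a b) (fderiv ℝ (transition c c') y w) := by
  have hy' : transition c c' y ∈ (extChartAt (𝓡 d) c').target := extChartAt_mem_target hy.2
  rw [christoffel_eq_koszulForm hy.1, christoffel_eq_koszulForm hy']
  refine koszulForm_pullback (differentiableAt_metricForm hy.1) (differentiableAt_metricForm hy')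
    ((contDiffAt_transition hy).of_le ENat.LEInfty.out) ?_ (metricForm_symm c' _) a b w
  filter_upwards [(isOpen_overlap c c').mem_nhds hy] with q hq
  exact metricForm_transition hq

end SmoothMetric

section ParallelFields

variable [IsManifold (𝓡 d) ∞ M] [RiemannianBundle (fun x : M => TangentSpace (𝓡 d) x)]

/-- The equation of parallel fields along `γ` holds at time `t` in the chart around `c`, so that
`IsParallelOn γ V J` asks for `ParallelEqAt γ V J t c` at all `t ∈ J`, in all charts containing
`γ t`. -/
def ParallelEqAt (γ : ℝ → M) (V : (t : ℝ) → TangentSpace (𝓡 d) (γ t)) (J : Set ℝ) (t : ℝ)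
    (c : M) : Prop :=
  ∃ V' : 𝔼, HasDerivWithinAt (fun s => coord c (γ s) (V s)) V' J t ∧
    ∀ w : 𝔼, chartMetric c (extChartAt (𝓡 d) c (γ t)) V' w +
      christoffel c (extChartAt (𝓡 d) c (γ t)) (coord c (γ t) (velocity γ t))
        (coord c (γ t) (V t)) w = 0

variable {γ : ℝ → M} {V W : (t : ℝ) → TangentSpace (𝓡 d) (γ t)} {J J' : Set ℝ} {t : ℝ} {c c' : M}

lemma ParallelEqAt.congr_of_mem_nhdsWithin (h : ParallelEqAt γ V J t c) (htJ : t ∈ J)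
    (hVW : ∀ s ∈ J, W s = V s) (hJ : J ∈ nhdsWithin t J') : ParallelEqAt γ W J' t c := by
  obtain ⟨V', hV', hw⟩ := h
  refine ⟨V', (hV'.congr (fun s hs => ?_) ?_).mono_of_mem_nhdsWithin hJ, fun w => ?_⟩
  · rw [hVW s hs]
  · rw [hVW t htJ]
  · rw [hVW t htJ]; exact hw w

lemma ParallelEqAt.union (hc : γ t ∈ (chartAt 𝔼 c).source) (h : ParallelEqAt γ V J t c)
    (h' : ParallelEqAt γ V J' t c) : ParallelEqAt γ V (J ∪ J') t c := by
  obtain ⟨V₁, hV₁, hw₁⟩ := h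
  obtain ⟨V₂, hV₂, hw₂⟩ := h'
  obtain rfl : V₁ = V₂ := by
    refine (isInvertible_metricForm (extChartAt_mem_target hc)).injective
      (ContinuousLinearMap.ext fun w => ?_)
    simp only [metricForm_apply]
    linarith [hw₁ w, hw₂ w]
  exact ⟨V₁, hV₁.union hV₂, hw₁⟩

lemma IsParallelOn.mono (h : IsParallelOn γ V J) (hJ : J' ⊆ J) : IsParallelOn γ V J' :=
  fun t ht c hc =>
    let ⟨V', hV', hw⟩ := h t (hJ ht) c hc
    ⟨V', hV'.mono hJ, hw⟩

lemma IsParallelOn.glue {a b e : ℝ} (hab : a ≤ b) (hbe : b ≤ e) (hV : IsParallelOn γ V (Icc a b))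
    (hW : IsParallelOn γ W (Icc b e)) (hVW : V b = W b) :
    IsParallelOn γ (fun s => if s ≤ b then V s else W s) (Icc a e) := by
  have eq_left : ∀ s ∈ Icc a b, (if s ≤ b then V s else W s) = V s := fun s hs => if_pos hs.2
  have eq_right : ∀ s ∈ Icc b e, (if s ≤ b then V s else W s) = W s := by
    intro s hs
    rcases hs.1.eq_or_lt with rfl | hlt
    · rw [if_pos le_rfl, hVW]
    · exact if_neg (not_le.2 hlt)
  intro t ht c hc
  rcases lt_trichotomy t b with hlt | rfl | hgt
  · have htJ : t ∈ Icc a b := ⟨ht.1, hlt.le⟩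
    refine ParallelEqAt.congr_of_mem_nhdsWithin (hV t htJ c hc) htJ eq_left ?_
    filter_upwards [self_mem_nhdsWithin, nhdsWithin_le_nhds (Iio_mem_nhds hlt)] with s hs hs'
    exact ⟨hs.1, hs'.le⟩
  · have htJ : t ∈ Icc a t := ⟨ht.1, le_rfl⟩
    have htJ' : t ∈ Icc t e := ⟨le_rfl, ht.2⟩
    have hunion := ParallelEqAt.union hc
      (ParallelEqAt.congr_of_mem_nhdsWithin (hV t htJ c hc) htJ eq_left self_mem_nhdsWithin)
      (ParallelEqAt.congr_of_mem_nhdsWithin (hW t htJ' c hc) htJ' eq_right self_mem_nhdsWithin)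
    rwa [Icc_union_Icc_eq_Icc hab hbe] at hunion
  · have htJ : t ∈ Icc b e := ⟨hgt.le, ht.2⟩
    refine ParallelEqAt.congr_of_mem_nhdsWithin (hW t htJ c hc) htJ eq_right ?_
    filter_upwards [self_mem_nhdsWithin, nhdsWithin_le_nhds (Ioi_mem_nhds hgt)] with s hs hs'
    exact ⟨hs'.le, hs.2⟩

variable [IsContMDiffRiemannianBundle (𝓡 d) ∞ (EuclideanSpace ℝ (Fin d))
  (fun x : M => TangentSpace (𝓡 d) x)]

lemma ParallelEqAt.change_chart (hγ : MDifferentiableAt 𝓘(ℝ, ℝ) (𝓡 d) γ t) (htJ : t ∈ J)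
    (hc : γ t ∈ (chartAt 𝔼 c).source) (hc' : γ t ∈ (chartAt 𝔼 c').source)
    (h : ParallelEqAt γ V J t c) : ParallelEqAt γ V J t c' := by
  obtain ⟨V', hV', hw⟩ := h
  have hz := extChartAt_mem_overlap hc hc'
  have hderiv := hasDerivWithinAt_fderiv_apply
    ((contDiffAt_transition hz).of_le ENat.LEInfty.out) (hasDerivAt_extChartAt_comp hγ hc) hV'
  have hcoord : ∀ᶠ s in nhdsWithin t J, coord c' (γ s) (V s) =
      fderiv ℝ (transition c c') (extChartAt (𝓡 d) c (γ s)) (coord c (γ s) (V s)) := by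
    have hmem : ∀ᶠ s in nhds t, γ s ∈ (chartAt 𝔼 c).source ∩ (chartAt 𝔼 c').source :=
      hγ.continuousAt.eventually_mem
        (((chartAt 𝔼 c).open_source.inter (chartAt 𝔼 c').open_source).mem_nhds ⟨hc, hc'⟩)
    filter_upwards [nhdsWithin_le_nhds hmem] with s hs
    exact coord_eq_fderiv_transition hs.1 hs.2 _
  refine ⟨_, hderiv.congr_of_eventuallyEq hcoord (hcoord.self_of_nhdsWithin htJ), fun w' => ?_⟩
  obtain ⟨w, rfl⟩ : ∃ w, fderiv ℝ (transition c c') (extChartAt (𝓡 d) c (γ t)) w = w' :=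
    ⟨coord c (γ t) (uncoord c' (γ t) w'), by
      rw [← coord_eq_fderiv_transition hc hc', coord_uncoord hc']⟩
  have heq := hw w
  rw [christoffel_transition hz, ← metricForm_apply, metricForm_transition hz] at heq
  rw [coord_eq_fderiv_transition hc hc', coord_eq_fderiv_transition hc hc',
    ← transition_extChartAt hc, ← metricForm_apply, map_add, add_apply]
  linarith

lemma IsParallelOn.add (hV : IsParallelOn γ V J) (hW : IsParallelOn γ W J) :
    IsParallelOn γ (fun s => V s + W s) J := by
  intro t ht c hc
  obtain ⟨V', hV', hw⟩ := hV t ht c hc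
  obtain ⟨W', hW', hw'⟩ := hW t ht c hc
  refine ⟨V' + W', ?_, fun w => ?_⟩
  · simp only [coord_add]
    exact hV'.add hW'
  · have hVw := hw w
    have hWw := hw' w
    simp only [christoffel_eq_koszulForm (extChartAt_mem_target hc), ← metricForm_apply, coord_add,
      map_add, add_apply] at hVw hWw ⊢
    linear_combination hVw + hWw

lemma IsParallelOn.smul (hV : IsParallelOn γ V J) (r : ℝ) :
    IsParallelOn γ (fun s => r • V s) J := by
  intro t ht c hc
  obtain ⟨V', hV', hw⟩ := hV t ht c hc
  refine ⟨r • V', ?_, fun w => ?_⟩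
  · simp only [coord_smul]
    exact hV'.const_smul r
  · have hVw := hw w
    simp only [christoffel_eq_koszulForm (extChartAt_mem_target hc), ← metricForm_apply, coord_smul,
      map_smul, smul_apply, smul_eq_mul] at hVw ⊢
    linear_combination r * hVw

lemma hasDerivWithinAt_inner_of_isParallelOn (hγ : MDifferentiableAt 𝓘(ℝ, ℝ) (𝓡 d) γ t)
    (htJ : t ∈ J) (hV : IsParallelOn γ V J) (hW : IsParallelOn γ W J) :
    HasDerivWithinAt (fun s => inner ℝ (V s) (W s)) 0 J t := by
  have hc : γ t ∈ (chartAt 𝔼 (γ t)).source := mem_chart_source _ _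
  have hz := extChartAt_mem_target hc
  obtain ⟨V', hV', hw⟩ := hV t htJ (γ t) hc
  obtain ⟨W', hW', hw'⟩ := hW t htJ (γ t) hc
  have hderiv := hasDerivWithinAt_bilinear_apply (differentiableAt_metricForm hz)
    (hasDerivAt_extChartAt_comp hγ hc) hV' hW'
  rw [← christoffel_add_christoffel_swap hz] at hderiv
  have hcoord : ∀ᶠ s in nhdsWithin t J, inner ℝ (V s) (W s) =
      metricForm (γ t) (extChartAt (𝓡 d) (γ t) (γ s)) (coord (γ t) (γ s) (V s))
        (coord (γ t) (γ s) (W s)) := by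
    have hmem : ∀ᶠ s in nhds t, γ s ∈ (chartAt 𝔼 (γ t)).source :=
      hγ.continuousAt.eventually_mem ((chartAt 𝔼 (γ t)).open_source.mem_nhds hc)
    filter_upwards [nhdsWithin_le_nhds hmem] with s hs
    exact inner_eq_chartMetric hs _ _
  have hVW := hw (coord (γ t) (γ t) (W t))
  have hWV := hw' (coord (γ t) (γ t) (V t))
  rw [← metricForm_apply] at hVW hWV
  rw [metricForm_symm] at hWV
  convert! hderiv.congr_of_eventuallyEq hcoord (hcoord.self_of_nhdsWithin htJ) using 1
  linarith

lemma IsParallelOn.inner_eq {a b : ℝ} (hγ : MDifferentiable 𝓘(ℝ, ℝ) (𝓡 d) γ)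
    (hV : IsParallelOn γ V (Icc a b)) (hW : IsParallelOn γ W (Icc a b)) (ht : t ∈ Icc a b) :
    inner ℝ (V t) (W t) = inner ℝ (V a) (W a) := by
  have h : ∀ s ∈ Icc a b, HasDerivWithinAt (fun s => inner ℝ (V s) (W s)) 0 (Icc a b) s :=
    fun s hs => hasDerivWithinAt_inner_of_isParallelOn (hγ s) hs hV hW
  refine constant_of_derivWithin_zero (f := fun s => inner ℝ (V s) (W s))
    (fun s hs => (h s hs).differentiableWithinAt) (fun s hs => ?_) t ht
  exact (h s (Ico_subset_Icc_self hs)).derivWithin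
    (uniqueDiffOn_Icc (hs.1.trans_lt hs.2) s (Ico_subset_Icc_self hs))

lemma IsParallelOn.norm_eq {a b : ℝ} (hγ : MDifferentiable 𝓘(ℝ, ℝ) (𝓡 d) γ)
    (hV : IsParallelOn γ V (Icc a b)) (ht : t ∈ Icc a b) : ‖V t‖ = ‖V a‖ := by
  rw [norm_eq_sqrt_real_inner, norm_eq_sqrt_real_inner, hV.inner_eq hγ hV ht]

lemma IsParallelOn.eq_of_eq {a b : ℝ} (hγ : MDifferentiable 𝓘(ℝ, ℝ) (𝓡 d) γ)
    (hV : IsParallelOn γ V (Icc a b)) (hW : IsParallelOn γ W (Icc a b)) (h : V a = W a)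
    (ht : t ∈ Icc a b) : V t = W t := by
  have hnorm := (hV.add (hW.smul (-1))).norm_eq hγ ht
  rwa [h, neg_one_smul, neg_one_smul, add_neg_cancel, norm_zero, norm_eq_zero,
    add_neg_eq_zero] at hnorm

end ParallelFields

section ParallelFieldExistence

lemma exists_linearODE_solution {V : Type*} [NormedAddCommGroup V] [NormedSpace ℝ V]
    [CompleteSpace V] {A : ℝ → V →L[ℝ] V} {a b K : ℝ} (hab : a ≤ b)
    (hA : ContinuousOn A (Icc a b)) (hK : ∀ t ∈ Icc a b, ‖A t‖ ≤ K) (hKab : K * (b - a) ≤ 1 / 2)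
    (y₀ : V) :
    ∃ y : ℝ → V, y a = y₀ ∧ ∀ t ∈ Icc a b, HasDerivWithinAt y (A t (y t)) (Icc a b) t := by
  have hK₀ : 0 ≤ K := (norm_nonneg _).trans (hK a (left_mem_Icc.2 hab))
  have hradius : 0 ≤ ‖y₀‖ + 1 := by positivity
  have hspeed : 0 ≤ K * (2 * ‖y₀‖ + 1) := by positivity
  have hPL : IsPicardLindelof (fun t y => A t y) (⟨a, left_mem_Icc.2 hab⟩ : Icc a b) y₀
      ⟨‖y₀‖ + 1, hradius⟩ 0 ⟨K * (2 * ‖y₀‖ + 1), hspeed⟩ ⟨K, hK₀⟩ := by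
    refine ⟨fun t ht => ?_, fun y _ => hA.clm_apply continuousOn_const, fun t ht y hy => ?_, ?_⟩
    · exact ((A t).lipschitz.weaken (hK t ht)).lipschitzOnWith
    · have hy' : ‖y‖ ≤ 2 * ‖y₀‖ + 1 := by
        have hsub : ‖y - y₀‖ ≤ ‖y₀‖ + 1 := mem_closedBall_iff_norm.1 hy
        linarith [norm_le_norm_add_norm_sub' y y₀]
      exact ((A t).le_opNorm y).trans (mul_le_mul (hK t ht) hy' (norm_nonneg _) hK₀)
    · change K * (2 * ‖y₀‖ + 1) * max (b - a) (a - a) ≤ ‖y₀‖ + 1 - 0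
      rw [sub_self, max_eq_left (sub_nonneg.2 hab)]
      nlinarith [norm_nonneg y₀]
  exact hPL.exists_eq_forall_mem_Icc_hasDerivWithinAt₀

variable [IsManifold (𝓡 d) ∞ M] [RiemannianBundle (fun x : M => TangentSpace (𝓡 d) x)]

/-- In the chart around `c`, the field with coordinates `y` along `γ` is parallel if and only if
`y' = parallelOperator γ c t y`; the velocity is written as the derivative of the coordinates of
`γ`. -/
def parallelOperator (γ : ℝ → M) (c : M) (t : ℝ) : 𝔼 →L[ℝ] 𝔼 :=
  -(metricForm c (extChartAt (𝓡 d) c (γ t))).inverse.comp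
    (koszulForm (fderiv ℝ (metricForm c) (extChartAt (𝓡 d) c (γ t)))
      (deriv (fun s => extChartAt (𝓡 d) c (γ s)) t))

variable [IsContMDiffRiemannianBundle (𝓡 d) ∞ (EuclideanSpace ℝ (Fin d))
  (fun x : M => TangentSpace (𝓡 d) x)] {γ : ℝ → M}

lemma continuousAt_parallelOperator (hγ : ContMDiff 𝓘(ℝ, ℝ) (𝓡 d) ∞ γ) {c : M} {t : ℝ}
    (hc : γ t ∈ (chartAt 𝔼 c).source) : ContinuousAt (parallelOperator (d := d) γ c) t := by
  have hz := extChartAt_mem_target hc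
  have hcurve : ContDiffAt ℝ ∞ (fun s => extChartAt (𝓡 d) c (γ s)) t :=
    ((contMDiffAt_extChartAt' hc).comp t (hγ t)).contDiffAt
  have hderiv : ContinuousAt (deriv fun s => extChartAt (𝓡 d) c (γ s)) t :=
    (hcurve.continuousAt_fderiv (by simp)).clm_apply continuousAt_const
  have hmetric : ContinuousAt (fun s => metricForm c (extChartAt (𝓡 d) c (γ s))) t :=
    (contDiffAt_metricForm hz).continuousAt.comp (f := fun s => extChartAt (𝓡 d) c (γ s))
      hcurve.continuousAt
  have hinverse : ContinuousAt
      (fun s => (metricForm c (extChartAt (𝓡 d) c (γ s))).inverse) t :=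
    ((isInvertible_metricForm hz).contDiffAt_map_inverse (n := 0)).continuousAt.comp
      (f := fun s => metricForm c (extChartAt (𝓡 d) c (γ s))) hmetric
  have hfderiv : ContinuousAt
      (fun s => fderiv ℝ (metricForm c) (extChartAt (𝓡 d) c (γ s))) t :=
    ((contDiffAt_metricForm hz).continuousAt_fderiv (by simp)).comp
      (f := fun s => extChartAt (𝓡 d) c (γ s)) hcurve.continuousAt
  exact (hinverse.clm_comp (continuous_koszulForm.continuousAt.comp (hfderiv.prodMk hderiv))).neg

lemma isParallelOn_uncoord (hγ : MDifferentiable 𝓘(ℝ, ℝ) (𝓡 d) γ) {c : M} {J : Set ℝ}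
    (hc : ∀ t ∈ J, γ t ∈ (chartAt 𝔼 c).source) {y : ℝ → 𝔼}
    (hy : ∀ t ∈ J, HasDerivWithinAt y (parallelOperator γ c t (y t)) J t) :
    IsParallelOn γ (fun t => uncoord c (γ t) (y t)) J := by
  intro t ht c' hc'
  have hz := extChartAt_mem_target (hc t ht)
  refine ParallelEqAt.change_chart (hγ t) ht (hc t ht) hc'
    ⟨parallelOperator γ c t (y t), ?_, fun w => ?_⟩
  · exact (hy t ht).congr (fun s hs => coord_uncoord (hc s hs) _) (coord_uncoord (hc t ht) _)
  · rw [coord_uncoord (hc t ht), ← metricForm_apply, parallelOperator,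
      (hasDerivAt_extChartAt_comp (hγ t) (hc t ht)).deriv, neg_apply, map_neg, neg_apply,
      ContinuousLinearMap.comp_apply, (isInvertible_metricForm hz).self_apply_inverse,
      christoffel_eq_koszulForm hz, neg_add_cancel]

lemma exists_isParallelOn_nhds (hγ : ContMDiff 𝓘(ℝ, ℝ) (𝓡 d) ∞ γ) (t₀ : ℝ) :
    ∃ ε > 0, ∀ a b, a ≤ b → Icc a b ⊆ Metric.ball t₀ ε → ∀ w : TangentSpace (𝓡 d) (γ a),
      ∃ V : (t : ℝ) → TangentSpace (𝓡 d) (γ t), IsParallelOn γ V (Icc a b) ∧ V a = w := by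
  set c := γ t₀
  set K := ‖parallelOperator (d := d) γ c t₀‖ + 1
  have hK : 0 < K := by positivity
  have hc : γ t₀ ∈ (chartAt 𝔼 c).source := mem_chart_source _ _
  have hmem : ∀ᶠ s in nhds t₀, γ s ∈ (chartAt 𝔼 c).source :=
    hγ.continuous.continuousAt.eventually_mem ((chartAt 𝔼 c).open_source.mem_nhds hc)
  have hbound : ∀ᶠ s in nhds t₀, ‖parallelOperator (d := d) γ c s‖ < K :=
    (continuousAt_parallelOperator hγ hc).norm.eventually_lt_const (lt_add_one _)
  obtain ⟨δ, hδ, hball⟩ := Metric.eventually_nhds_iff_ball.1 (hmem.and hbound)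
  refine ⟨min δ (1 / (4 * K)), by positivity, fun a b hab hsub w => ?_⟩
  have hchart : ∀ t ∈ Icc a b, γ t ∈ (chartAt 𝔼 c).source ∧ ‖parallelOperator γ c t‖ < K :=
    fun t ht => hball t (Metric.ball_subset_ball (min_le_left _ _) (hsub ht))
  have hlen : K * (b - a) ≤ 1 / 2 := by
    have ha := Metric.ball_subset_ball (min_le_right _ _) (hsub (left_mem_Icc.2 hab))
    have hb := Metric.ball_subset_ball (min_le_right _ _) (hsub (right_mem_Icc.2 hab))
    rw [Metric.mem_ball, Real.dist_eq, abs_lt] at ha hb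
    calc K * (b - a) ≤ K * (2 * (1 / (4 * K))) := by gcongr; linarith [ha.1, hb.2]
      _ = 1 / 2 := by field_simp; norm_num
  obtain ⟨y, hya, hy⟩ := exists_linearODE_solution hab
    (fun t ht => (continuousAt_parallelOperator hγ (hchart t ht).1).continuousWithinAt)
    (fun t ht => (hchart t ht).2.le) hlen (coord c (γ a) w)
  refine ⟨_, isParallelOn_uncoord (hγ.mdifferentiable (by simp)) (fun t ht => (hchart t ht).1) hy,
    ?_⟩
  rw [hya, uncoord_coord (hchart a (left_mem_Icc.2 hab)).1]

lemma exists_isParallelOn (hγ : ContMDiff 𝓘(ℝ, ℝ) (𝓡 d) ∞ γ) {a b : ℝ} (hab : a ≤ b)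
    (w : TangentSpace (𝓡 d) (γ a)) :
    ∃ V : (t : ℝ) → TangentSpace (𝓡 d) (γ t), IsParallelOn γ V (Icc a b) ∧ V a = w := by
  choose ε hε hlocal using exists_isParallelOn_nhds hγ
  obtain ⟨t, ht₀, ht_mono, ⟨m, hm⟩, hsub⟩ := exists_monotone_Icc_subset_open_cover_Icc hab
    (c := fun i : ℝ => {s : Icc a b | (s : ℝ) ∈ Metric.ball i (ε i)})
    (fun i => Metric.isOpen_ball.preimage continuous_subtype_val)
    (fun s _ => mem_iUnion.2 ⟨s, Metric.mem_ball_self (hε _)⟩)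
  have hextend : ∀ n, ∃ V : (t : ℝ) → TangentSpace (𝓡 d) (γ t),
      IsParallelOn γ V (Icc a (t n)) ∧ V a = w := by
    intro n
    induction n with
    | zero =>
      refine hlocal a a (t 0) (by rw [ht₀]) ?_ w
      rw [ht₀, Icc_self, singleton_subset_iff]
      exact Metric.mem_ball_self (hε _)
    | succ n ih =>
      obtain ⟨V, hV, hVa⟩ := ih
      obtain ⟨i, hi⟩ := hsub n
      have hle : (t n : ℝ) ≤ t (n + 1) := ht_mono n.le_succ
      have hball : Icc (t n : ℝ) (t (n + 1)) ⊆ Metric.ball i (ε i) := fun s hs =>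
        hi (show ⟨s, (t n).2.1.trans hs.1, hs.2.trans (t (n + 1)).2.2⟩ ∈ Icc (t n) (t (n + 1))
          from ⟨hs.1, hs.2⟩)
      obtain ⟨W, hW, hWa⟩ := hlocal i (t n) (t (n + 1)) hle hball (V (t n))
      exact ⟨_, hV.glue (t n).2.1 hle hW hWa.symm, by rw [if_pos (t n).2.1, hVa]⟩
  have hfinal := hextend m
  rwa [hm m le_rfl] at hfinal

end ParallelFieldExistence

section Gradient

lemma mdifferentiable_average {n : ℕ} {f : Fin n → M → ℝ}
    (hf : ∀ i, MDifferentiable (𝓡 d) 𝓘(ℝ, ℝ) (f i)) :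
    MDifferentiable (𝓡 d) 𝓘(ℝ, ℝ) (average f) := fun x => by
  have h := (MDifferentiableAt.sum (t := Finset.univ) fun i _ => hf i x).const_smul ((n : ℝ)⁻¹)
  convert! h using 1
  ext y
  simp [average]

variable [RiemannianBundle (fun x : M => TangentSpace (𝓡 d) x)]

lemma inner_grad (f : M → ℝ) (x : M) (v : TangentSpace (𝓡 d) x) :
    inner ℝ (grad f x) v = mfderiv (𝓡 d) 𝓘(ℝ, ℝ) f x v := by
  have : FiniteDimensional ℝ (TangentSpace (𝓡 d) x) := inferInstanceAs (FiniteDimensional ℝ 𝔼)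
  have : CompleteSpace (TangentSpace (𝓡 d) x) := FiniteDimensional.complete ℝ _
  let df : TangentSpace (𝓡 d) x →L[ℝ] ℝ := mfderiv (𝓡 d) 𝓘(ℝ, ℝ) f x
  exact InnerProductSpace.toDual_symm_apply (𝕜 := ℝ) (x := v) (y := df)

lemma grad_average {n : ℕ} {f : Fin n → M → ℝ} {x : M}
    (hf : ∀ i, MDifferentiableAt (𝓡 d) 𝓘(ℝ, ℝ) (f i) x) :
    grad (d := d) (average f) x = (n : ℝ)⁻¹ • ∑ i, grad (f i) x := by
  have hderiv := (HasMFDerivAt.sum (t := Finset.univ)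
    fun i _ => (hf i).hasMFDerivAt).const_smul ((n : ℝ)⁻¹)
  have havg : ((n : ℝ)⁻¹ • ∑ i, f i) = average f := by
    ext y
    simp [average]
  rw [havg] at hderiv
  refine ext_inner_right ℝ fun v => ?_
  rw [inner_grad, hderiv.mfderiv, real_inner_smul_left, sum_inner]
  simp_rw [inner_grad]
  let df : Fin n → TangentSpace (𝓡 d) x →L[ℝ] ℝ := fun i => mfderiv (𝓡 d) 𝓘(ℝ, ℝ) (f i) x
  change (n : ℝ)⁻¹ * ((∑ i, df i) v) = (n : ℝ)⁻¹ * ∑ i, df i v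
  rw [sum_apply]

lemma hasDerivAt_comp_curve {f : M → ℝ} {γ : ℝ → M} {t : ℝ}
    (hf : MDifferentiableAt (𝓡 d) 𝓘(ℝ, ℝ) f (γ t)) (hγ : MDifferentiableAt 𝓘(ℝ, ℝ) (𝓡 d) γ t) :
    HasDerivAt (fun s => f (γ s)) (inner ℝ (grad (d := d) f (γ t)) (velocity γ t)) t := by
  let D : ℝ →L[ℝ] ℝ := (mfderiv (𝓡 d) 𝓘(ℝ, ℝ) f (γ t)).comp (mfderiv 𝓘(ℝ, ℝ) (𝓡 d) γ t)
  have hD : HasFDerivAt (fun s => f (γ s)) D t :=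
    (hf.hasMFDerivAt.comp t hγ.hasMFDerivAt).hasFDerivAt
  rw [inner_grad]
  exact hD.hasDerivAt

end Gradient

lemma velocity_comp_mul {γ : ℝ → M} (hγ : MDifferentiable 𝓘(ℝ, ℝ) (𝓡 d) γ) (r t : ℝ) :
    velocity (d := d) (fun s => γ (r * s)) t = r • velocity (d := d) γ (r * t) := by
  have hmul : HasFDerivAt (fun s : ℝ => r * s) (r • ContinuousLinearMap.id ℝ ℝ) t :=
    (ContinuousLinearMap.id ℝ ℝ).hasFDerivAt.const_mul (x := t) r
  have hcomp : mfderiv 𝓘(ℝ, ℝ) (𝓡 d) (fun s => γ (r * s)) t = _ :=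
    ((hγ (r * t)).hasMFDerivAt.comp (x := t) (f := fun s : ℝ => r * s) hmul.hasMFDerivAt).mfderiv
  rw [velocity, hcomp]
  exact map_smul (mfderiv 𝓘(ℝ, ℝ) (𝓡 d) γ (r * t)) r (1 : ℝ)

section Transport

variable [IsManifold (𝓡 d) ∞ M] [RiemannianBundle (fun x : M => TangentSpace (𝓡 d) x)]

section InitialConditions

variable {x : M} {v : TangentSpace (𝓡 d) x} {γ : ℝ → M}

lemma isGeodesicFrom_geodesic (hM : GeodesicallyComplete d M) (x : M) (v : TangentSpace (𝓡 d) x) :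
    IsGeodesicFrom x v (geodesic x v) := by
  rw [geodesic, dif_pos (hM x v)]
  exact (hM x v).choose_spec

lemma IsGeodesicFrom.zero (hγ : IsGeodesicFrom x v γ) : γ 0 = x := congrArg TotalSpace.proj hγ.2

lemma IsGeodesicFrom.of_initial {P : (y : M) → TangentSpace (𝓡 d) y → Prop}
    (hγ : IsGeodesicFrom x v γ) (h : P (γ 0) (velocity γ 0)) : P x v :=
  (congrArg (fun q : TangentBundle (𝓡 d) M => P q.1 q.2) hγ.2).mp h

lemma GSmooth.norm_grad_expMap_sub_le {L : ℝ} {f : M → ℝ} (hM : GeodesicallyComplete d M)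
    (hf : GSmooth (d := d) L f) (x : M) (v : TangentSpace (𝓡 d) x) :
    ‖grad f (expMap x v) - expTransport x v (grad f x)‖ ≤ L * ‖v‖ :=
  have hγ := isGeodesicFrom_geodesic hM x v
  hγ.of_initial (P := fun y w =>
    ‖grad f (geodesic x v 1) - transport (geodesic x v) y (grad f y)‖ ≤ L * ‖w‖) (hf.2 _ hγ.1)

end InitialConditions

variable [IsContMDiffRiemannianBundle (𝓡 d) ∞ (EuclideanSpace ℝ (Fin d))
  (fun x : M => TangentSpace (𝓡 d) x)]

section ParallelTransport

variable {γ : ℝ → M} {x : M}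

lemma transport_eq (hγ : ContMDiff 𝓘(ℝ, ℝ) (𝓡 d) ∞ γ) {V : (t : ℝ) → TangentSpace (𝓡 d) (γ t)}
    (hV : IsParallelOn γ V (Icc 0 1)) : transport γ (γ 0) (V 0) = V 1 := by
  have hex : ∃ W : (t : ℝ) → TangentSpace (𝓡 d) (γ t), IsParallelOn γ W (Icc 0 1) ∧
      (⟨γ 0, W 0⟩ : TangentBundle (𝓡 d) M) = (⟨γ 0, V 0⟩ : TangentBundle (𝓡 d) M) :=
    ⟨V, hV, rfl⟩
  have hzero : hex.choose 0 = V 0 := by simpa using hex.choose_spec.2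
  rw [transport, dif_pos hex]
  exact hex.choose_spec.1.eq_of_eq (hγ.mdifferentiable (by simp)) hV hzero
    (right_mem_Icc.2 zero_le_one)

lemma transport_add (hγ : ContMDiff 𝓘(ℝ, ℝ) (𝓡 d) ∞ γ) (hx : γ 0 = x)
    (v w : TangentSpace (𝓡 d) x) :
    transport γ x (v + w) = transport γ x v + transport γ x w := by
  subst hx
  obtain ⟨V, hV, rfl⟩ := exists_isParallelOn hγ zero_le_one v
  obtain ⟨W, hW, rfl⟩ := exists_isParallelOn hγ zero_le_one w
  rw [transport_eq hγ hV, transport_eq hγ hW]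
  exact transport_eq hγ (hV.add hW)

lemma transport_smul (hγ : ContMDiff 𝓘(ℝ, ℝ) (𝓡 d) ∞ γ) (hx : γ 0 = x) (r : ℝ)
    (v : TangentSpace (𝓡 d) x) : transport γ x (r • v) = r • transport γ x v := by
  subst hx
  obtain ⟨V, hV, rfl⟩ := exists_isParallelOn hγ zero_le_one v
  rw [transport_eq hγ hV]
  exact transport_eq hγ (hV.smul r)

lemma norm_transport (hγ : ContMDiff 𝓘(ℝ, ℝ) (𝓡 d) ∞ γ) (hx : γ 0 = x)
    (v : TangentSpace (𝓡 d) x) : ‖transport γ x v‖ = ‖v‖ := by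
  subst hx
  obtain ⟨V, hV, rfl⟩ := exists_isParallelOn hγ zero_le_one v
  rw [transport_eq hγ hV, hV.norm_eq (hγ.mdifferentiable (by simp)) (right_mem_Icc.2 zero_le_one)]

/-- Parallel transport along a smooth curve, from its time `0` to its time `1`, as a linear
isometry. -/
def transportₗᵢ (hγ : ContMDiff 𝓘(ℝ, ℝ) (𝓡 d) ∞ γ) (hx : γ 0 = x) :
    TangentSpace (𝓡 d) x →ₗᵢ[ℝ] TangentSpace (𝓡 d) (γ 1) where
  toFun := transport γ x
  map_add' := transport_add hγ hx
  map_smul' := transport_smul hγ hx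
  norm_map' := norm_transport hγ hx

lemma coe_transportₗᵢ (hγ : ContMDiff 𝓘(ℝ, ℝ) (𝓡 d) ∞ γ) (hx : γ 0 = x) :
    ⇑(transportₗᵢ hγ hx) = transport γ x := rfl

/-- Parallel transport along the geodesic `t ↦ Exp_x(t v)` as a linear isometry. -/
def expTransportₗᵢ (hM : GeodesicallyComplete d M) (x : M) (v : TangentSpace (𝓡 d) x) :
    TangentSpace (𝓡 d) x →ₗᵢ[ℝ] TangentSpace (𝓡 d) (expMap x v) :=
  transportₗᵢ (isGeodesicFrom_geodesic hM x v).1.1 (isGeodesicFrom_geodesic hM x v).zero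

lemma GSmooth.average {n : ℕ} {f : Fin n → M → ℝ} {L : ℝ} (hn : 0 < n)
    (hf : ∀ i, GSmooth (d := d) L (f i)) : GSmooth (d := d) L (average f) := by
  refine ⟨mdifferentiable_average fun i => (hf i).1, fun γ hγ => ?_⟩
  rw [grad_average fun i => (hf i).1 _, grad_average fun i => (hf i).1 _,
    ← coe_transportₗᵢ hγ.1 rfl, map_smul, map_sum, ← smul_sub, ← Finset.sum_sub_distrib, norm_smul,
    Real.norm_of_nonneg (by positivity), inv_mul_le_iff₀ (by positivity)]
  refine (norm_sum_le_of_le _ fun i _ => (hf i).2 γ hγ).trans_eq ?_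
  rw [Finset.sum_const, Finset.card_univ, Fintype.card_fin, nsmul_eq_mul]

end ParallelTransport

section Reparametrization

variable {γ : ℝ → M}

lemma IsParallelOn.comp_mul {V : (t : ℝ) → TangentSpace (𝓡 d) (γ t)} {J J' : Set ℝ} {r : ℝ}
    (hγ : MDifferentiable 𝓘(ℝ, ℝ) (𝓡 d) γ) (hV : IsParallelOn γ V J)
    (hr : MapsTo (fun s => r * s) J' J) :
    IsParallelOn (fun s => γ (r * s)) (fun s => V (r * s)) J' := by
  intro t ht c hc
  obtain ⟨V', hV', hw⟩ := hV (r * t) (hr ht) c hc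
  have hmul : HasDerivWithinAt (fun s : ℝ => r * s) r J' t := by
    simpa using (hasDerivWithinAt_id t J').const_mul r
  refine ⟨r • V', HasDerivWithinAt.scomp t hV' hmul hr, fun w => ?_⟩
  have heq := hw w
  rw [velocity_comp_mul hγ, coord_smul]
  simp only [christoffel_eq_koszulForm (extChartAt_mem_target hc), ← metricForm_apply,
    koszulForm_apply, map_smul, smul_apply, smul_eq_mul] at heq ⊢
  linear_combination r * heq

lemma IsGeodesic.comp_mul (hγ : IsGeodesic d γ) (r : ℝ) : IsGeodesic d (fun s => γ (r * s)) := by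
  have hd : MDifferentiable 𝓘(ℝ, ℝ) (𝓡 d) γ := hγ.1.mdifferentiable (by simp)
  refine ⟨hγ.1.comp (contDiff_const.mul contDiff_id).contMDiff, ?_⟩
  convert! (hγ.2.comp_mul hd (mapsTo_univ (fun s => r * s) univ)).smul r using 2 with s
  exact velocity_comp_mul hd r s

end Reparametrization

end Transport

lemma le_add_of_hasDerivAt_le_affine {φ φ' : ℝ → ℝ} {a b : ℝ}
    (hφ : ∀ t, HasDerivAt φ (φ' t) t) (h : ∀ t ∈ Icc (0 : ℝ) 1, φ' t ≤ a + b * t) :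
    φ 1 ≤ φ 0 + a + b / 2 := by
  have hB (t : ℝ) : HasDerivAt (fun t => φ 0 + a * t + b / 2 * t ^ 2) (a + b * t) t := by
    convert! (((hasDerivAt_id t).const_mul a).const_add (φ 0)).add
      ((hasDerivAt_pow 2 t).const_mul (b / 2)) using 1
    push_cast
    ring
  have hle := image_le_of_deriv_right_le_deriv_boundary (a := 0) (b := 1)
    (fun t _ => (hφ t).continuousAt.continuousWithinAt)
    (fun t _ => (hφ t).hasDerivWithinAt) (by simp)
    (fun t _ => (hB t).continuousAt.continuousWithinAt) (fun t _ => (hB t).hasDerivWithinAt)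
    (fun t ht => h t (Ico_subset_Icc_self ht)) (right_mem_Icc.2 zero_le_one)
  linarith

section DescentLemma

variable [IsManifold (𝓡 d) ∞ M] [RiemannianBundle (fun x : M => TangentSpace (𝓡 d) x)]
  [IsContMDiffRiemannianBundle (𝓡 d) ∞ (EuclideanSpace ℝ (Fin d))
    (fun x : M => TangentSpace (𝓡 d) x)]
  {L t : ℝ} {f : M → ℝ} {γ : ℝ → M}

lemma GSmooth.norm_grad_sub_le (hf : GSmooth (d := d) L f) (hγ : IsGeodesic d γ)
    {V : (t : ℝ) → TangentSpace (𝓡 d) (γ t)} (hV : IsParallelOn γ V (Icc 0 1))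
    (hV₀ : V 0 = grad f (γ 0)) (ht : t ∈ Icc (0 : ℝ) 1) :
    ‖grad f (γ t) - V t‖ ≤ L * (t * ‖velocity (d := d) γ 0‖) := by
  have hd : MDifferentiable 𝓘(ℝ, ℝ) (𝓡 d) γ := hγ.1.mdifferentiable (by simp)
  have hW : IsParallelOn (fun s => γ (t * s)) (fun s => V (t * s)) (Icc 0 1) :=
    hV.comp_mul hd fun s hs => ⟨mul_nonneg ht.1 hs.1, mul_le_one₀ ht.2 hs.1 hs.2⟩
  -- `t * 0` and `t * 1` cannot be rewritten directly: they occur in the types of vectors.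
  have hgrad : ∀ s, s = 0 → grad f (γ s) = V s := by rintro s rfl; exact hV₀.symm
  have hend : ∀ s, s = t → ‖grad f (γ s) - V s‖ = ‖grad f (γ t) - V t‖ := by rintro s rfl; rfl
  have hvel : ∀ s, s = 0 → ‖velocity (d := d) γ s‖ = ‖velocity (d := d) γ 0‖ := by
    rintro s rfl; rfl
  have hle := hf.2 _ (hγ.comp_mul t)
  rwa [hgrad _ (mul_zero t), transport_eq (hγ.comp_mul t).1 hW, velocity_comp_mul hd, norm_smul,
    Real.norm_of_nonneg ht.1, hend _ (mul_one t), hvel _ (mul_zero t)] at hle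

lemma GSmooth.inner_grad_velocity_le (hf : GSmooth (d := d) L f) (hγ : IsGeodesic d γ)
    (ht : t ∈ Icc (0 : ℝ) 1) :
    inner ℝ (grad (d := d) f (γ t)) (velocity γ t) ≤
      inner ℝ (grad (d := d) f (γ 0)) (velocity γ 0) + L * ‖velocity (d := d) γ 0‖ ^ 2 * t := by
  have hd : MDifferentiable 𝓘(ℝ, ℝ) (𝓡 d) γ := hγ.1.mdifferentiable (by simp)
  obtain ⟨V, hV, hV₀⟩ := exists_isParallelOn hγ.1 zero_le_one (grad (d := d) f (γ 0))
  have hvel : IsParallelOn γ (velocity γ) (Icc 0 1) := hγ.2.mono (subset_univ _)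
  have hdiff : inner ℝ (grad (d := d) f (γ t) - V t) (velocity γ t) ≤
      L * (t * ‖velocity (d := d) γ 0‖) * ‖velocity (d := d) γ 0‖ := by
    refine (real_inner_le_norm _ _).trans ?_
    rw [hvel.norm_eq hd ht]
    gcongr
    exact hf.norm_grad_sub_le hγ hV hV₀ ht
  rw [inner_sub_left, hV.inner_eq hd hvel ht, hV₀] at hdiff
  linarith

lemma GSmooth.le_of_isGeodesic (hf : GSmooth (d := d) L f) (hγ : IsGeodesic d γ) :
    f (γ 1) ≤ f (γ 0) + inner ℝ (grad (d := d) f (γ 0)) (velocity γ 0)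
      + L / 2 * ‖velocity (d := d) γ 0‖ ^ 2 := by
  have hle := le_add_of_hasDerivAt_le_affine
    (fun t => hasDerivAt_comp_curve (hf.1 (γ t)) (hγ.1.mdifferentiable (by simp) t))
    (fun t ht => hf.inner_grad_velocity_le hγ ht)
  linarith

lemma GSmooth.expMap_le (hM : GeodesicallyComplete d M) (hf : GSmooth (d := d) L f) (x : M)
    (v : TangentSpace (𝓡 d) x) :
    f (expMap x v) ≤ f x + inner ℝ (grad f x) v + L / 2 * ‖v‖ ^ 2 :=
  have hγ := isGeodesicFrom_geodesic hM x v
  hγ.of_initial (P := fun y w => f (expMap x v) ≤ f y + inner ℝ (grad f y) w + L / 2 * ‖w‖ ^ 2)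
    (hf.le_of_isGeodesic hγ.1)

end DescentLemma

section Variance

variable {Ω : Type*} {mΩ : MeasurableSpace Ω} {P : Measure Ω} {H : Type*} [NormedAddCommGroup H]
  [InnerProductSpace ℝ H] {X Y : Ω → H}

lemma integrable_inner_of_memLp (hX : MemLp X 2 P) (hY : MemLp Y 2 P) :
    Integrable (fun a => (inner ℝ (X a) (Y a) : ℝ)) P :=
  (hX.norm.integrable_mul hY.norm).mono' (hX.aestronglyMeasurable.inner hY.aestronglyMeasurable)
    (Filter.Eventually.of_forall fun a => norm_inner_le_norm (X a) (Y a))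

lemma integral_inner_eq_zero_of_indepFun [IsFiniteMeasure P] [CompleteSpace H] [MeasurableSpace H]
    [BorelSpace H] (hXY : IndepFun X Y P) (hX : Integrable X P) (hY : Integrable Y P)
    (hmean : ∫ a, X a ∂P = 0) : ∫ a, (inner ℝ (X a) (Y a) : ℝ) ∂P = 0 := by
  have h := hXY.integral_bilin hX hY (innerSL ℝ)
  rwa [hmean, map_zero] at h

lemma integral_norm_sum_sq {ι : Type*} [Fintype ι] {ξ : ι → Ω → H} (hξ : ∀ i, MemLp (ξ i) 2 P)
    (horth : Pairwise fun i j => ∫ a, (inner ℝ (ξ i a) (ξ j a) : ℝ) ∂P = 0) :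
    ∫ a, ‖∑ i, ξ i a‖ ^ 2 ∂P = ∑ i, ∫ a, ‖ξ i a‖ ^ 2 ∂P := by
  have hint (i j) : Integrable (fun a => (inner ℝ (ξ i a) (ξ j a) : ℝ)) P :=
    integrable_inner_of_memLp (hξ i) (hξ j)
  simp_rw [← real_inner_self_eq_norm_sq, sum_inner, inner_sum]
  rw [integral_finsetSum _ fun i _ => integrable_finsetSum _ fun j _ => hint i j]
  refine Finset.sum_congr rfl fun i _ => ?_
  rw [integral_finsetSum _ fun j _ => hint i j,
    Finset.sum_eq_single i (fun j _ hj => horth hj.symm) (by simp)]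

lemma integral_norm_const_add_sq [IsProbabilityMeasure P] [CompleteSpace H] (hX : MemLp X 2 P)
    (hmean : ∫ a, X a ∂P = 0) (v : H) :
    ∫ a, ‖v + X a‖ ^ 2 ∂P = ‖v‖ ^ 2 + ∫ a, ‖X a‖ ^ 2 ∂P := by
  have hint : Integrable X P := hX.integrable one_le_two
  have hinner : Integrable (fun a => 2 * (inner ℝ v (X a) : ℝ)) P :=
    (hint.const_inner v).const_mul 2
  have hlin : Integrable (fun a => ‖v‖ ^ 2 + 2 * (inner ℝ v (X a) : ℝ)) P :=
    (integrable_const _).add hinner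
  simp_rw [norm_add_sq_real]
  rw [integral_add hlin (hX.integrable_norm_pow two_ne_zero),
    integral_add (integrable_const _) hinner, integral_const_mul, integral_inner hint, hmean]
  simp

lemma integral_norm_const_add_sum_sq_pi {ι : Type*} [Fintype ι] {S : ι → Type*}
    [∀ i, MeasurableSpace (S i)] {ν : (i : ι) → Measure (S i)} [∀ i, IsProbabilityMeasure (ν i)]
    [CompleteSpace H] {ξ : (i : ι) → S i → H} (hξ : ∀ i, MemLp (ξ i) 2 (ν i))
    (hmean : ∀ i, ∫ s, ξ i s ∂(ν i) = 0) (v : H) :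
    ∫ s, ‖v + ∑ i, ξ i (s i)‖ ^ 2 ∂(Measure.pi ν) = ‖v‖ ^ 2 + ∑ i, ∫ s, ‖ξ i s‖ ^ 2 ∂(ν i) := by
  borelize H
  have hmem (i : ι) : MemLp (fun s : (i : ι) → S i => ξ i (s i)) 2 (Measure.pi ν) :=
    (hξ i).comp_measurePreserving (measurePreserving_eval ν i)
  have hint (i : ι) : Integrable (fun s : (i : ι) → S i => ξ i (s i)) (Measure.pi ν) :=
    (hmem i).integrable one_le_two
  have hzero (i : ι) : ∫ s : (i : ι) → S i, ξ i (s i) ∂(Measure.pi ν) = 0 :=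
    (integral_comp_eval (hξ i).aestronglyMeasurable).trans (hmean i)
  have hindep : iIndepFun (fun i (s : (i : ι) → S i) => ξ i (s i)) (Measure.pi ν) :=
    iIndepFun_pi fun i => (hξ i).aestronglyMeasurable.aemeasurable
  have hsum : ∫ s : (i : ι) → S i, ∑ i, ξ i (s i) ∂(Measure.pi ν) = 0 := by
    rw [integral_finsetSum _ fun i _ => hint i, Finset.sum_eq_zero fun i _ => hzero i]
  have horth : Pairwise fun i j =>
      ∫ s : (i : ι) → S i, (inner ℝ (ξ i (s i)) (ξ j (s j)) : ℝ) ∂(Measure.pi ν) = 0 :=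
    fun _ _ hij =>
      integral_inner_eq_zero_of_indepFun (hindep.indepFun hij) (hint _) (hint _) (hzero _)
  have hadd := integral_norm_const_add_sq (X := fun s : (i : ι) → S i => ∑ i, ξ i (s i))
    (memLp_finsetSum _ fun i _ => hmem i) hsum v
  have hsq := integral_norm_sum_sq hmem horth
  have hsingle (i : ι) : ∫ s : (i : ι) → S i, ‖ξ i (s i)‖ ^ 2 ∂(Measure.pi ν) =
      ∫ s, ‖ξ i s‖ ^ 2 ∂(ν i) :=
    integral_comp_eval (f := fun s => ‖ξ i s‖ ^ 2) ((hξ i).aestronglyMeasurable.norm.pow 2)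
  simp only [hadd, hsq, hsingle]

end Variance

section Measurability

lemma measurable_of_countable_cover {α β ι : Type*} [Countable ι] [MeasurableSpace α]
    [MeasurableSpace β] {g : α → β} {t : ι → Set α} (ht : ∀ i, MeasurableSet (t i))
    (hcover : ⋃ i, t i = univ) {h : ι → α → β} (hh : ∀ i, Measurable (h i))
    (heq : ∀ i, EqOn g (h i) (t i)) : Measurable g := by
  intro B hB
  rw [← univ_inter (g ⁻¹' B), ← hcover, iUnion_inter]
  refine MeasurableSet.iUnion fun i => ?_
  rw [(heq i).inter_preimage_eq]
  exact (ht i).inter (hh i hB)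

lemma measurable_indicator_of_continuousOn {X Y : Type*} [TopologicalSpace X] [MeasurableSpace X]
    [OpensMeasurableSpace X] [TopologicalSpace Y] [MeasurableSpace Y] [BorelSpace Y] [Zero Y]
    {s : Set X} (hs : MeasurableSet s) {g : X → Y} (hg : ContinuousOn g s) :
    Measurable (s.indicator g) := by
  classical
  rw [← piecewise_eq_indicator]
  exact hg.measurable_piecewise continuousOn_const hs

variable [IsManifold (𝓡 d) ∞ M]

instance tangentBundleBorelSpace : BorelSpace (TangentBundle (𝓡 d) M) := ⟨rfl⟩

lemma coord_of_notMem {c x : M} (hx : x ∉ (chartAt 𝔼 c).source) (v : TangentSpace (𝓡 d) x) :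
    coord c x v = 0 := by
  have hbase : x ∉ (trivializationAt 𝔼 (fun y : M => TangentSpace (𝓡 d) y) c).baseSet := hx
  rw [coord, Trivialization.continuousLinearMapAt_apply,
    Trivialization.linearMapAt_def_of_notMem _ hbase]
  rfl

lemma measurable_coord (c : M) :
    Measurable (fun q : TangentBundle (𝓡 d) M => coord c q.1 q.2) := by
  let e := trivializationAt 𝔼 (fun y : M => TangentSpace (𝓡 d) y) c
  have hsnd : ContinuousOn (fun q : TangentBundle (𝓡 d) M => (e q).2) e.source :=
    continuous_snd.comp_continuousOn e.continuousOn
  convert! measurable_indicator_of_continuousOn e.open_source.measurableSet hsnd using 1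
  ext1 q
  by_cases hq : q ∈ e.source
  · rw [indicator_of_mem hq]
    exact Trivialization.continuousLinearMapAt_apply_of_mem (R := ℝ) e (e.mem_source.1 hq) q.2
  · rw [indicator_of_notMem hq]
    exact coord_of_notMem (fun h => hq (e.mem_source.2 h)) _

lemma measurable_of_measurable_tangentBundle [MeasurableSpace M] [BorelSpace M] {α : Type*}
    [MeasurableSpace α] {x : α → M} {u : (a : α) → TangentSpace (𝓡 d) (x a)}
    (h : Measurable fun a => (⟨x a, u a⟩ : TangentBundle (𝓡 d) M)) : Measurable x :=
  (FiberBundle.continuous_proj 𝔼 (fun y : M => TangentSpace (𝓡 d) y)).measurable.comp h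

/-- The vector field `u` along the map `x` has measurable coordinates in every chart. Unlike the
measurability of `a ↦ (x a, u a)` in the tangent bundle, this is visibly stable under the linear
operations. -/
def MeasurableField {α : Type*} [MeasurableSpace α] (x : α → M)
    (u : (a : α) → TangentSpace (𝓡 d) (x a)) : Prop :=
  ∀ c : M, Measurable fun a => coord c (x a) (u a)

namespace MeasurableField

variable {α : Type*} [MeasurableSpace α] {x : α → M} {u v : (a : α) → TangentSpace (𝓡 d) (x a)}

lemma of_measurable (h : Measurable fun a => (⟨x a, u a⟩ : TangentBundle (𝓡 d) M)) :
    MeasurableField x u :=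
  fun c => (measurable_coord c).comp h

lemma add (hu : MeasurableField x u) (hv : MeasurableField x v) :
    MeasurableField x (fun a => u a + v a) := fun c => by
  simp only [coord_add]
  exact (hu c).add (hv c)

lemma sub (hu : MeasurableField x u) (hv : MeasurableField x v) :
    MeasurableField x (fun a => u a - v a) := fun c => by
  simp only [coord_sub]
  exact (hu c).sub (hv c)

lemma const_smul (hu : MeasurableField x u) (r : ℝ) : MeasurableField x (fun a => r • u a) :=
  fun c => by
  simp only [coord_smul]
  exact (hu c).const_smul r

lemma sum {ι : Type*} {s : Finset ι} {w : ι → (a : α) → TangentSpace (𝓡 d) (x a)}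
    (hw : ∀ i, MeasurableField x (w i)) : MeasurableField x (fun a => ∑ i ∈ s, w i a) :=
  fun c => by
  simp only [coord_sum]
  exact Finset.measurable_fun_sum s fun i _ => hw i c

lemma ite {p : α → Prop} [DecidablePred p] (hp : MeasurableSet {a | p a})
    (hu : MeasurableField x u) (hv : MeasurableField x v) :
    MeasurableField x (fun a => if p a then u a else v a) := fun c => by
  simp only [apply_ite (coord c _)]
  exact Measurable.ite hp (hu c) (hv c)

end MeasurableField

lemma continuousOn_metricForm_extChartAt [RiemannianBundle (fun x : M => TangentSpace (𝓡 d) x)]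
    [IsContMDiffRiemannianBundle (𝓡 d) ∞ (EuclideanSpace ℝ (Fin d))
      (fun x : M => TangentSpace (𝓡 d) x)] (c : M) :
    ContinuousOn (fun y => metricForm (d := d) c (extChartAt (𝓡 d) c y)) (chartAt 𝔼 c).source :=
  fun y hy => ((contDiffAt_metricForm (extChartAt_mem_target hy)).continuousAt.comp
    (f := extChartAt (𝓡 d) c)
    (continuousAt_extChartAt' (by rwa [extChartAt_source]))).continuousWithinAt

lemma norm_sq_eq_metricForm [RiemannianBundle (fun x : M => TangentSpace (𝓡 d) x)] {c x : M}
    (hx : x ∈ (chartAt 𝔼 c).source) (v : TangentSpace (𝓡 d) x) :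
    ‖v‖ ^ 2 = metricForm c (extChartAt (𝓡 d) c x) (coord c x v) (coord c x v) := by
  rw [← real_inner_self_eq_norm_sq, metricForm_apply, inner_eq_chartMetric hx]

lemma coord_grad [RiemannianBundle (fun x : M => TangentSpace (𝓡 d) x)] {f : M → ℝ} {c x : M}
    (hf : MDifferentiableAt (𝓡 d) 𝓘(ℝ, ℝ) f x) (hx : x ∈ (chartAt 𝔼 c).source) :
    coord c x (grad f x) = (metricForm c (extChartAt (𝓡 d) c x)).inverse
      (fderiv ℝ (f ∘ (extChartAt (𝓡 d) c).symm) (extChartAt (𝓡 d) c x)) := by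
  have hinv := isInvertible_metricForm (extChartAt_mem_target hx)
  rw [← hinv.inverse_apply_self (coord c x (grad f x))]
  congr 1
  ext w
  rw [metricForm_apply, ← coord_uncoord hx w, ← inner_eq_chartMetric hx, inner_grad,
    mfderiv_eq_fderiv_comp_extChartAt_symm hx hf, coord_uncoord hx]

variable [RiemannianBundle (fun x : M => TangentSpace (𝓡 d) x)]
  [IsContMDiffRiemannianBundle (𝓡 d) ∞ (EuclideanSpace ℝ (Fin d))
    (fun x : M => TangentSpace (𝓡 d) x)]
  [MeasurableSpace M] [BorelSpace M] {α : Type*} [MeasurableSpace α] {x : α → M}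

lemma MeasurableField.norm_sq [SecondCountableTopology M]
    {u : (a : α) → TangentSpace (𝓡 d) (x a)} (hx : Measurable x) (hu : MeasurableField x u) :
    Measurable fun a => ‖u a‖ ^ 2 := by
  obtain ⟨s, hs, hcover⟩ :=
    TopologicalSpace.countable_cover_nhds (chart_source_mem_nhds 𝔼 (M := M))
  have : Countable s := hs.to_subtype
  have hmetric (c : M) : Measurable ((chartAt 𝔼 c).source.indicator
      fun y => metricForm c (extChartAt (𝓡 d) c y)) :=
    measurable_indicator_of_continuousOn (chartAt 𝔼 c).open_source.measurableSet
      (continuousOn_metricForm_extChartAt c)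
  refine measurable_of_countable_cover (t := fun c : s => x ⁻¹' (chartAt 𝔼 (c : M)).source)
    (fun c => hx (chartAt 𝔼 (c : M)).open_source.measurableSet)
    (by rw [← preimage_iUnion, iUnion_subtype, hcover, preimage_univ])
    (fun c => ContinuousLinearMap.measurable_apply₂.comp
      ((ContinuousLinearMap.measurable_apply₂.comp
        (((hmetric c).comp hx).prodMk (hu c))).prodMk (hu c)))
    fun c a ha => ?_
  simp only [Function.comp_apply, indicator_of_mem (mem_preimage.1 ha), norm_sq_eq_metricForm ha]

lemma measurableField_grad {f : M → ℝ} (hf : MDifferentiable (𝓡 d) 𝓘(ℝ, ℝ) f)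
    (hx : Measurable x) : MeasurableField (d := d) x (fun a => grad f (x a)) := by
  intro c
  suffices h : Measurable fun y : M => coord (d := d) c y (grad f y) from h.comp hx
  have hsource := (chartAt 𝔼 c).open_source.measurableSet
  have hinverse : Measurable ((chartAt 𝔼 c).source.indicator
      fun y => (metricForm c (extChartAt (𝓡 d) c y)).inverse) :=
    measurable_indicator_of_continuousOn hsource fun y hy =>
      ((isInvertible_metricForm (extChartAt_mem_target hy)).contDiffAt_map_inverse
        (n := 0)).continuousAt.comp_continuousWithinAt
          (f := fun y => metricForm c (extChartAt (𝓡 d) c y))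
          (continuousOn_metricForm_extChartAt c y hy)
  have hchart : Measurable ((chartAt 𝔼 c).source.indicator (extChartAt (𝓡 d) c)) :=
    measurable_indicator_of_continuousOn hsource
      (by simpa only [extChartAt_source] using continuousOn_extChartAt (I := 𝓡 d) c)
  convert! ContinuousLinearMap.measurable_apply₂.comp (hinverse.prodMk
    ((measurable_fderiv ℝ (f ∘ (extChartAt (𝓡 d) c).symm)).comp hchart)) using 1
  ext1 y
  by_cases hy : y ∈ (chartAt 𝔼 c).source
  · simp only [Function.comp_apply, indicator_of_mem hy, coord_grad (hf y) hy]
  · simp only [Function.comp_apply, indicator_of_notMem hy, coord_of_notMem hy, zero_apply]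

end Measurability

section OneStep

lemma lintegral_stepLaw {S : Type*} [MeasurableSpace S] (n : ℕ) (p : ℝ) (ν : Measure S)
    [SigmaFinite ν] (H : Bool × (Fin n → S) → ENNReal) :
    ∫⁻ z, H z ∂(stepLaw n p ν) =
      ENNReal.ofReal p * ∫⁻ s, H (true, s) ∂(Measure.pi fun _ => ν) +
        ENNReal.ofReal (1 - p) * ∫⁻ s, H (false, s) ∂(Measure.pi fun _ => ν) := by
  rw [stepLaw, Measure.add_prod, Measure.prod_smul_left, Measure.prod_smul_left,
    Measure.dirac_prod, Measure.dirac_prod, lintegral_add_measure, lintegral_smul_measure,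
    lintegral_smul_measure, (measurableEmbedding_prodMk_left _).lintegral_map,
    (measurableEmbedding_prodMk_left _).lintegral_map, smul_eq_mul, smul_eq_mul]

variable {n : ℕ} [IsManifold (𝓡 d) ∞ M] [RiemannianBundle (fun x : M => TangentSpace (𝓡 d) x)]

section Compressor

variable {S : Type*} [MeasurableSpace S] {ν : Measure S} [IsProbabilityMeasure ν] {omega : ℝ}

lemma IsUnbiasedCompressor.memLp_sub
    {Q : (x : M) → S → TangentSpace (𝓡 d) x → TangentSpace (𝓡 d) x}
    (hQ : IsUnbiasedCompressor ν omega Q) (x : M) (y : TangentSpace (𝓡 d) x) :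
    MemLp (fun s => Q x s y - y) 2 ν :=
  (memLp_two_iff_integrable_sq_norm
    ((hQ.integrable x y).sub (integrable_const y)).aestronglyMeasurable).2 (hQ.integrable_sq x y)

lemma IsUnbiasedCompressor.integral_sub_eq_zero
    {Q : (x : M) → S → TangentSpace (𝓡 d) x → TangentSpace (𝓡 d) x}
    (hQ : IsUnbiasedCompressor ν omega Q) (x : M) (y : TangentSpace (𝓡 d) x) :
    ∫ s, (Q x s y - y) ∂ν = 0 := by
  have : FiniteDimensional ℝ (TangentSpace (𝓡 d) x) := inferInstanceAs (FiniteDimensional ℝ 𝔼)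
  have : CompleteSpace (TangentSpace (𝓡 d) x) := FiniteDimensional.complete ℝ _
  rw [integral_sub (hQ.integrable x y) (integrable_const y), hQ.unbiased, integral_const,
    probReal_univ, one_smul, sub_self]

variable {Q : Fin n → (x : M) → S → TangentSpace (𝓡 d) x → TangentSpace (𝓡 d) x}

lemma memLp_add_average_compression_error (hQ : ∀ i, IsUnbiasedCompressor ν omega (Q i)) (x : M)
    (v : TangentSpace (𝓡 d) x) (y : Fin n → TangentSpace (𝓡 d) x) :
    MemLp (fun s : Fin n → S => v + (n : ℝ)⁻¹ • ∑ i, (Q i x (s i) (y i) - y i)) 2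
      (Measure.pi fun _ => ν) := by
  have hmem (i : Fin n) : MemLp (fun s : Fin n → S => Q i x (s i) (y i) - y i) 2
      (Measure.pi fun _ => ν) :=
    ((hQ i).memLp_sub x (y i)).comp_measurePreserving (measurePreserving_eval (fun _ => ν) i)
  exact (memLp_const v).add ((memLp_finsetSum _ fun i _ => hmem i).const_smul (n : ℝ)⁻¹)

lemma integral_norm_add_average_compression_error_sq_le
    (hQ : ∀ i, IsUnbiasedCompressor ν omega (Q i)) (x : M) (v : TangentSpace (𝓡 d) x)
    (y : Fin n → TangentSpace (𝓡 d) x) :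
    ∫ s, ‖v + (n : ℝ)⁻¹ • ∑ i, (Q i x (s i) (y i) - y i)‖ ^ 2 ∂(Measure.pi fun _ => ν) ≤
      ‖v‖ ^ 2 + (n : ℝ)⁻¹ ^ 2 * (omega * ∑ i, ‖y i‖ ^ 2) := by
  have : FiniteDimensional ℝ (TangentSpace (𝓡 d) x) := inferInstanceAs (FiniteDimensional ℝ 𝔼)
  have : CompleteSpace (TangentSpace (𝓡 d) x) := FiniteDimensional.complete ℝ _
  have hpi := integral_norm_const_add_sum_sq_pi (ν := fun _ => ν)
    (ξ := fun i s => (n : ℝ)⁻¹ • (Q i x s (y i) - y i))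
    (fun i => ((hQ i).memLp_sub x (y i)).const_smul (n : ℝ)⁻¹)
    (fun i => by rw [integral_smul, (hQ i).integral_sub_eq_zero, smul_zero]) v
  simp only [norm_smul, mul_pow, integral_const_mul, norm_inv, Real.norm_natCast,
    ← Finset.mul_sum, ← Finset.smul_sum] at hpi
  rw [hpi, Finset.mul_sum _ _ omega]
  gcongr with i
  exact (hQ i).variance_le x (y i)

end Compressor

section Stepsize

variable {L γ p : ℝ}

lemma mul_sq_le_one_sub_of_le_one_div {s : ℝ} (hL : 0 < L) (hγ : 0 ≤ γ) (hs : 0 ≤ s)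
    (hle : γ ≤ 1 / (L * (1 + √s))) : s * (L * γ) ^ 2 ≤ 1 - L * γ := by
  have hnonneg : 0 ≤ √s * (L * γ) := by positivity
  have hlinear : √s * (L * γ) ≤ 1 - L * γ := by
    rw [le_div_iff₀ (by positivity)] at hle
    linarith
  calc s * (L * γ) ^ 2 = (√s * (L * γ)) ^ 2 := by rw [mul_pow (√s), Real.sq_sqrt hs]
    _ ≤ √s * (L * γ) := pow_le_of_le_one hnonneg (by nlinarith) two_ne_zero
    _ ≤ 1 - L * γ := hlinear

lemma mul_le_half_of_le_div {μ : ℝ} (hμ : 0 < μ) (hle : γ ≤ p / (2 * μ)) : γ * μ ≤ p / 2 := by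
  rw [le_div_iff₀ (by positivity)] at hle
  linarith

lemma lyapunov_decrease {F F' E G a μ κ : ℝ} (hE : 0 ≤ E) (hG : 0 ≤ G) (hp : 0 < p)
    (hγ : 0 ≤ γ) (hstep : 2 * (1 - p) / p * κ * (L * γ) ^ 2 ≤ 1 - L * γ) (hγμ : γ * μ ≤ p / 2)
    (hF' : F' ≤ F + γ / 2 * (E - G - a) + L / 2 * (γ ^ 2 * G)) (ha : 2 * μ * F ≤ a) :
    F' + (1 - p) * (γ / p * (E + κ * ((L * γ) ^ 2 * G))) ≤ (1 - γ * μ) * (F + γ / p * E) :=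
  calc F' + (1 - p) * (γ / p * (E + κ * ((L * γ) ^ 2 * G)))
    _ ≤ F + γ / 2 * (E - G - a) + L / 2 * (γ ^ 2 * G) +
        (1 - p) * (γ / p * (E + κ * ((L * γ) ^ 2 * G))) := by gcongr
    _ = F - γ / 2 * a + γ / p * ((1 - p / 2) * E) -
        γ / 2 * ((1 - L * γ - 2 * (1 - p) / p * κ * (L * γ) ^ 2) * G) := by
      field_simp
      ring
    _ ≤ F - γ / 2 * (2 * μ * F) + γ / p * ((1 - γ * μ) * E) - 0 := by
      have hnonneg : 0 ≤ γ / 2 * ((1 - L * γ - 2 * (1 - p) / p * κ * (L * γ) ^ 2) * G) :=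
        mul_nonneg (by positivity) (mul_nonneg (by linarith) hG)
      gcongr
    _ = (1 - γ * μ) * (F + γ / p * E) := by ring

end Stepsize

namespace State

/-- The error `gᵏ - ∇f(xᵏ)` of the gradient estimator. -/
def err (f : Fin n → M → ℝ) (σ : State d n M) : TangentSpace (𝓡 d) σ.point :=
  σ.mean - grad (average f) σ.point

/-- The Lyapunov function `f(xᵏ) - f* + a ‖gᵏ - ∇f(xᵏ)‖²`. -/
def lyapunov (f : Fin n → M → ℝ) (fstar a : ℝ) (σ : State d n M) : ℝ :=
  average f σ.point - fstar + a * ‖σ.err f‖ ^ 2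

variable {S : Type*} {f : Fin n → M → ℝ}

lemma err_step_true (Q : Fin n → (x : M) → S → TangentSpace (𝓡 d) x → TangentSpace (𝓡 d) x)
    (η : ℝ) (s : Fin n → S) (σ : State d n M)
    (hf : ∀ i, MDifferentiable (𝓡 d) 𝓘(ℝ, ℝ) (f i)) :
    (σ.step f Q η true s).err f = 0 := by
  rw [err, grad_average fun i => hf i _]
  exact sub_self _

lemma norm_diff_le (hM : GeodesicallyComplete d M) {L η : ℝ} (hη : 0 ≤ η) {i : Fin n}
    (hf : GSmooth (d := d) L (f i)) (σ : State d n M) :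
    ‖σ.diff f η i‖ ≤ L * (η * ‖σ.mean‖) := by
  have h : ‖σ.diff f η i‖ ≤ L * ‖-(η • σ.mean)‖ := hf.norm_grad_expMap_sub_le hM σ.point _
  rwa [norm_neg, norm_smul, Real.norm_of_nonneg hη] at h

variable [IsContMDiffRiemannianBundle (𝓡 d) ∞ (EuclideanSpace ℝ (Fin d))
  (fun x : M => TangentSpace (𝓡 d) x)]

/-- Parallel transport along one iteration as a linear isometry. -/
def moveₗᵢ (hM : GeodesicallyComplete d M) (η : ℝ) (σ : State d n M) :
    TangentSpace (𝓡 d) σ.point →ₗᵢ[ℝ] TangentSpace (𝓡 d) (σ.next η) :=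
  expTransportₗᵢ hM σ.point (-(η • σ.mean))

lemma err_step_false (hM : GeodesicallyComplete d M)
    (Q : Fin n → (x : M) → S → TangentSpace (𝓡 d) x → TangentSpace (𝓡 d) x) (η : ℝ)
    (s : Fin n → S) (σ : State d n M) (hf : ∀ i, MDifferentiable (𝓡 d) 𝓘(ℝ, ℝ) (f i)) :
    (σ.step f Q η false s).err f = σ.moveₗᵢ hM η (σ.err f) +
      (n : ℝ)⁻¹ • ∑ i, (Q i (σ.next η) (s i) (σ.diff f η i) - σ.diff f η i) := by
  have hworker (i : Fin n) : (σ.step f Q η false s).vec i - grad (f i) (σ.next η) =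
      (σ.moveₗᵢ hM η (σ.vec i) - σ.moveₗᵢ hM η (grad (f i) σ.point)) +
        (Q i (σ.next η) (s i) (σ.diff f η i) - σ.diff f η i) := by
    have hvec : (σ.step f Q η false s).vec i =
      σ.moveₗᵢ hM η (σ.vec i) + Q i (σ.next η) (s i) (σ.diff f η i) := rfl
    have hdiff : grad (f i) (σ.next η) =
      σ.diff f η i + σ.moveₗᵢ hM η (grad (f i) σ.point) := (sub_add_cancel _ _).symm
    rw [hvec, hdiff]
    abel
  rw [err, err, mean, mean, grad_average fun i => hf i _, grad_average fun i => hf i _, ← smul_sub,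
    ← smul_sub, map_smul, ← smul_add, map_sub, map_sum, map_sum, ← Finset.sum_sub_distrib,
    ← Finset.sum_sub_distrib, ← Finset.sum_add_distrib]
  exact congrArg _ (Finset.sum_congr rfl fun i _ => hworker i)

lemma average_next_le (hM : GeodesicallyComplete d M) (hn : 0 < n) {L η : ℝ}
    (hf : ∀ i, GSmooth (d := d) L (f i)) (σ : State d n M) :
    average f (σ.next η) ≤ average f σ.point +
      η / 2 * (‖σ.err f‖ ^ 2 - ‖σ.mean‖ ^ 2 - ‖grad (d := d) (average f) σ.point‖ ^ 2) +
      L / 2 * (η ^ 2 * ‖σ.mean‖ ^ 2) := by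
  have hpolar : inner ℝ (grad (average f) σ.point) (-(η • σ.mean)) =
      η / 2 * (‖σ.err f‖ ^ 2 - ‖σ.mean‖ ^ 2 - ‖grad (d := d) (average f) σ.point‖ ^ 2) := by
    rw [err, norm_sub_sq_real, inner_neg_right, real_inner_smul_right, real_inner_comm]
    ring
  have hdescent := (GSmooth.average hn hf).expMap_le hM σ.point (-(η • σ.mean))
  rwa [hpolar, norm_neg, norm_smul, mul_pow, Real.norm_eq_abs, sq_abs] at hdescent

section Expectation

variable [MeasurableSpace S] {ν : Measure S} [IsProbabilityMeasure ν] {omega : ℝ}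
  {Q : Fin n → (x : M) → S → TangentSpace (𝓡 d) x → TangentSpace (𝓡 d) x}

lemma integrable_norm_err_step_false_sq (hM : GeodesicallyComplete d M)
    (hf : ∀ i, MDifferentiable (𝓡 d) 𝓘(ℝ, ℝ) (f i))
    (hQ : ∀ i, IsUnbiasedCompressor ν omega (Q i)) (η : ℝ) (σ : State d n M) :
    Integrable (fun s => ‖(σ.step f Q η false s).err f‖ ^ 2) (Measure.pi fun _ => ν) := by
  simp only [err_step_false hM Q η _ σ hf]
  exact (memLp_add_average_compression_error hQ _ _ _).integrable_norm_pow two_ne_zero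

lemma integral_norm_err_step_false_sq_le (hM : GeodesicallyComplete d M) {L η : ℝ}
    (hη : 0 ≤ η) (hf : ∀ i, GSmooth (d := d) L (f i)) (homega : 0 ≤ omega)
    (hQ : ∀ i, IsUnbiasedCompressor ν omega (Q i)) (σ : State d n M) :
    ∫ s, ‖(σ.step f Q η false s).err f‖ ^ 2 ∂(Measure.pi fun _ => ν) ≤
      ‖σ.err f‖ ^ 2 + omega / n * ((L * η) ^ 2 * ‖σ.mean‖ ^ 2) := by
  have hdiff (i : Fin n) : ‖σ.diff f η i‖ ^ 2 ≤ (L * η) ^ 2 * ‖σ.mean‖ ^ 2 := by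
    rw [← mul_pow, mul_assoc]
    exact pow_le_pow_left₀ (norm_nonneg _) (σ.norm_diff_le hM hη (hf i)) 2
  simp only [err_step_false hM Q η _ σ fun i => (hf i).1]
  refine (integral_norm_add_average_compression_error_sq_le hQ _ _ _).trans ?_
  rw [LinearIsometry.norm_map]
  calc ‖σ.err f‖ ^ 2 + (n : ℝ)⁻¹ ^ 2 * (omega * ∑ i, ‖σ.diff f η i‖ ^ 2)
    _ ≤ ‖σ.err f‖ ^ 2 + (n : ℝ)⁻¹ ^ 2 * (omega * ∑ _i : Fin n, (L * η) ^ 2 * ‖σ.mean‖ ^ 2) := by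
      gcongr with i
      exact hdiff i
    _ = ‖σ.err f‖ ^ 2 + omega / n * ((L * η) ^ 2 * ‖σ.mean‖ ^ 2) := by
      rw [Finset.sum_const, Finset.card_univ, Fintype.card_fin, nsmul_eq_mul]
      rcases eq_or_ne (n : ℝ) 0 with hn | hn
      · simp [hn]
      · field_simp

lemma lintegral_lyapunov_step_false_le (hM : GeodesicallyComplete d M) {L η fstar a : ℝ}
    (hη : 0 ≤ η) (ha : 0 ≤ a) (hf : ∀ i, GSmooth (d := d) L (f i))
    (hfstar : ∀ x, fstar ≤ average f x) (homega : 0 ≤ omega)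
    (hQ : ∀ i, IsUnbiasedCompressor ν omega (Q i)) (σ : State d n M) :
    ∫⁻ s, ENNReal.ofReal ((σ.step f Q η false s).lyapunov f fstar a) ∂(Measure.pi fun _ => ν) ≤
      ENNReal.ofReal (average f (σ.next η) - fstar +
        a * (‖σ.err f‖ ^ 2 + omega / n * ((L * η) ^ 2 * ‖σ.mean‖ ^ 2))) := by
  have herr := (σ.integrable_norm_err_step_false_sq hM (fun i => (hf i).1) hQ η).const_mul a
  have hint : Integrable (fun s : Fin n → S => average f (σ.next η) - fstar +
      a * ‖(σ.step f Q η false s).err f‖ ^ 2) (Measure.pi fun _ => ν) :=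
    (integrable_const _).add herr
  have hlyapunov (s : Fin n → S) : (σ.step f Q η false s).lyapunov f fstar a =
      average f (σ.next η) - fstar + a * ‖(σ.step f Q η false s).err f‖ ^ 2 := rfl
  have hnonneg (s : Fin n → S) :
      0 ≤ average f (σ.next η) - fstar + a * ‖(σ.step f Q η false s).err f‖ ^ 2 :=
    add_nonneg (sub_nonneg.2 (hfstar _)) (by positivity)
  simp only [hlyapunov]
  rw [← ofReal_integral_eq_lintegral_ofReal hint (Filter.Eventually.of_forall hnonneg),
    integral_add (integrable_const _) herr, integral_const_mul, integral_const, probReal_univ,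
    one_smul]
  gcongr
  exact σ.integral_norm_err_step_false_sq_le hM hη hf homega hQ

lemma lintegral_lyapunov_step_le (hM : GeodesicallyComplete d M) (hn : 0 < n)
    {L μ fstar p γ : ℝ} (hL : 0 < L) (hμ : 0 < μ) (hf : ∀ i, GSmooth (d := d) L (f i))
    (hPL : PLCondition d μ fstar (average f)) (homega : 0 ≤ omega)
    (hQ : ∀ i, IsUnbiasedCompressor ν omega (Q i)) (hp : 0 < p) (hp1 : p ≤ 1) (hγ : 0 ≤ γ)
    (hγle : γ ≤ min (1 / (L * (1 + √(2 * (1 - p) * omega / (p * n))))) (p / (2 * μ)))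
    (σ : State d n M) :
    ∫⁻ z, ENNReal.ofReal ((σ.step f Q γ z.1 z.2).lyapunov f fstar (γ / p)) ∂(stepLaw n p ν) ≤
      ENNReal.ofReal (1 - γ * μ) * ENNReal.ofReal (σ.lyapunov f fstar (γ / p)) := by
  have hp' : 0 ≤ 1 - p := sub_nonneg.2 hp1
  have hgap : 0 ≤ average f (σ.next γ) - fstar := sub_nonneg.2 (hPL.1 _)
  have hγμ : γ * μ ≤ p / 2 := mul_le_half_of_le_div hμ (hγle.trans (min_le_right _ _))
  have hstep : 2 * (1 - p) / p * (omega / n) * (L * γ) ^ 2 ≤ 1 - L * γ := by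
    rw [div_mul_div_comm]
    exact mul_sq_le_one_sub_of_le_one_div hL hγ (by positivity) (hγle.trans (min_le_left _ _))
  have htrue (s : Fin n → S) : (σ.step f Q γ true s).lyapunov f fstar (γ / p) =
      average f (σ.next γ) - fstar := by
    rw [lyapunov, err_step_true Q γ s σ fun i => (hf i).1, norm_zero, zero_pow two_ne_zero,
      mul_zero, add_zero]
    rfl
  have hdescent : average f (σ.next γ) - fstar ≤ average f σ.point - fstar +
      γ / 2 * (‖σ.err f‖ ^ 2 - ‖σ.mean‖ ^ 2 - ‖grad (d := d) (average f) σ.point‖ ^ 2) +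
      L / 2 * (γ ^ 2 * ‖σ.mean‖ ^ 2) := by
    linarith [σ.average_next_le hM hn (η := γ) hf]
  have hdecrease := lyapunov_decrease (sq_nonneg _) (sq_nonneg _) hp hγ hstep hγμ hdescent
    (hPL.2 _)
  rw [lintegral_stepLaw, ← ENNReal.ofReal_mul (by linarith : 0 ≤ 1 - γ * μ)]
  simp only [htrue, lintegral_const, measure_univ, mul_one]
  refine (add_le_add_right (mul_le_mul_right (σ.lintegral_lyapunov_step_false_le hM hγ
    (div_nonneg hγ hp.le) hf hPL.1 homega hQ) _) _).trans ?_
  rw [← ENNReal.ofReal_mul hp.le, ← ENNReal.ofReal_mul hp', ← ENNReal.ofReal_add (by positivity)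
    (by positivity)]
  exact ENNReal.ofReal_le_ofReal (le_of_eq_of_le (by ring) hdecrease)

end Expectation

end State

end OneStep

section Independence

variable {Ω Ω' β : Type*} [MeasurableSpace β]

lemma lintegral_comp_prodMk_of_indepFun [MeasurableSpace Ω] [MeasurableSpace Ω'] {P : Measure Ω}
    [IsFiniteMeasure P] {Y : Ω → Ω'} {Z : Ω → β} (hY : Measurable Y) (hZ : Measurable Z)
    (hind : IndepFun Y Z P) {H : Ω' × β → ENNReal} (hH : Measurable H) :
    ∫⁻ a, H (Y a, Z a) ∂P = ∫⁻ a, ∫⁻ z, H (Y a, z) ∂(P.map Z) ∂P := by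
  rw [← lintegral_map hH (hY.prodMk hZ),
    (indepFun_iff_map_prod_eq_prod_map_map hY.aemeasurable hZ.aemeasurable).1 hind,
    lintegral_prod _ hH.aemeasurable, lintegral_map hH.lintegral_prod_right' hY]

lemma lintegral_comp_prodMk_of_indep {m mΩ : MeasurableSpace Ω} {P : Measure[mΩ] Ω}
    [IsFiniteMeasure P] (hm : m ≤ mΩ) {Z : Ω → β} (hZ : Measurable[mΩ] Z)
    (hind : Indep (MeasurableSpace.comap Z inferInstance) m P) {H : Ω × β → ENNReal}
    (hH : Measurable[m.prod inferInstance] H) :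
    ∫⁻ a, H (a, Z a) ∂P = ∫⁻ a, ∫⁻ z, H (a, z) ∂(P.map Z) ∂P := by
  have hid : @IndepFun Ω Ω β mΩ m _ id Z P := by
    refine (@IndepFun_iff_Indep Ω Ω β mΩ m _ id Z P).2 ?_
    rw [MeasurableSpace.comap_id]
    exact hind.symm
  exact @lintegral_comp_prodMk_of_indepFun Ω Ω β _ mΩ m P _ id Z (measurable_id'' hm) hZ hid H hH

lemma lintegral_le_pow_mul_of_indep {X : Type*} {mΩ : MeasurableSpace Ω} {P : Measure Ω}
    [IsFiniteMeasure P] (ℱ : Filtration ℕ mΩ) {Z : ℕ → Ω → β} (hZ : ∀ k, Measurable (Z k))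
    {law : Measure β} (hlaw : ∀ k, P.map (Z k) = law)
    (hind : ∀ k, Indep (MeasurableSpace.comap (Z k) inferInstance) (ℱ k) P)
    {ξ : ℕ → Ω → X} {T : β → X → X} (hξ : ∀ k a, ξ (k + 1) a = T (Z k a) (ξ k a))
    {H : X → ENNReal}
    (hmeas : ∀ k, Measurable[(ℱ k).prod inferInstance] fun q : Ω × β => H (T q.2 (ξ k q.1)))
    {ρ : ENNReal} (hρ : ρ ≠ ⊤) (hcontract : ∀ x, ∫⁻ z, H (T z x) ∂law ≤ ρ * H x) (k : ℕ) :
    ∫⁻ a, H (ξ k a) ∂P ≤ ρ ^ k * ∫⁻ a, H (ξ 0 a) ∂P := by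
  induction k with
  | zero => rw [pow_zero, one_mul]
  | succ k ih =>
    calc ∫⁻ a, H (ξ (k + 1) a) ∂P
      _ = ∫⁻ a, H (T (Z k a) (ξ k a)) ∂P := by simp only [hξ]
      _ = ∫⁻ a, ∫⁻ z, H (T z (ξ k a)) ∂law ∂P := by
        rw [← hlaw k]
        exact lintegral_comp_prodMk_of_indep (ℱ.le k) (hZ k) (hind k) (hmeas k)
      _ ≤ ∫⁻ a, ρ * H (ξ k a) ∂P := lintegral_mono fun a => hcontract _
      _ = ρ * ∫⁻ a, H (ξ k a) ∂P := lintegral_const_mul' _ _ hρ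
      _ ≤ ρ * (ρ ^ k * ∫⁻ a, H (ξ 0 a) ∂P) := by gcongr
      _ = ρ ^ (k + 1) * ∫⁻ a, H (ξ 0 a) ∂P := by rw [pow_succ', mul_assoc]

lemma integrable_and_integral_le_of_lintegral_ofReal_le [MeasurableSpace Ω] {P : Measure Ω}
    {X : Ω → ℝ} (hX : AEStronglyMeasurable X P) (hnonneg : 0 ≤ᵐ[P] X) {c : ℝ} (hc : 0 ≤ c)
    (hle : ∫⁻ a, ENNReal.ofReal (X a) ∂P ≤ ENNReal.ofReal c) :
    Integrable X P ∧ ∫ a, X a ∂P ≤ c := by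
  refine ⟨⟨hX, ?_⟩, ?_⟩
  · exact (hasFiniteIntegral_iff_ofReal hnonneg).2 (hle.trans_lt ENNReal.ofReal_lt_top)
  · rw [integral_eq_lintegral_of_nonneg_ae hnonneg hX]
    exact ENNReal.toReal_le_of_le_ofReal hc hle

end Independence

section Convergence

variable {n : ℕ} [IsManifold (𝓡 d) ∞ M] [RiemannianBundle (fun x : M => TangentSpace (𝓡 d) x)]
  {S : Type*}

lemma lyapunov_run_zero (f : Fin n → M → ℝ)
    (Q : Fin n → (x : M) → S → TangentSpace (𝓡 d) x → TangentSpace (𝓡 d) x) (η fstar b : ℝ)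
    (x₀ : M) (z : ℕ → Bool × (Fin n → S)) (hf : ∀ i, MDifferentiableAt (𝓡 d) 𝓘(ℝ, ℝ) (f i) x₀) :
    (run f Q η x₀ z 0).lyapunov f fstar b = average f x₀ - fstar := by
  have herr : (run f Q η x₀ z 0).err f = 0 := by
    rw [run, State.err, State.mean, grad_average hf, sub_self]
  rw [State.lyapunov, herr, norm_zero, zero_pow two_ne_zero, mul_zero, add_zero, run]

variable [IsContMDiffRiemannianBundle (𝓡 d) ∞ (EuclideanSpace ℝ (Fin d))
  (fun x : M => TangentSpace (𝓡 d) x)]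

lemma PLCondition.eq_of_forall_le (hM : GeodesicallyComplete d M) {f : M → ℝ} {L μ fstar : ℝ}
    (hL : 0 < L) (hμ : 0 < μ) (hf : GSmooth (d := d) L f) (hPL : PLCondition d μ fstar f) {x : M}
    (hx : ∀ y, f x ≤ f y) : f x = fstar := by
  have hdescent := hf.expMap_le hM x (-(L⁻¹ • grad (d := d) f x))
  have hgap : L / 2 * (L⁻¹ * ‖grad (d := d) f x‖) ^ 2 = L⁻¹ * ‖grad (d := d) f x‖ ^ 2 / 2 := by
    field_simp
  rw [inner_neg_right, real_inner_smul_right, real_inner_self_eq_norm_sq, norm_neg, norm_smul,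
    Real.norm_of_nonneg (inv_nonneg.2 hL.le), hgap] at hdescent
  have hgrad : L⁻¹ * ‖grad (d := d) f x‖ ^ 2 ≤ L⁻¹ * 0 := by
    linarith [hx (expMap x (-(L⁻¹ • grad (d := d) f x)))]
  have hle : 2 * μ * (f x - fstar) ≤ 2 * μ * 0 := by
    linarith [hPL.2 x, le_of_mul_le_mul_left hgrad (inv_pos.2 hL)]
  linarith [hPL.1 x, le_of_mul_le_mul_left hle (by positivity)]

variable [SecondCountableTopology M] {f : Fin n → M → ℝ}

lemma State.measurable_lyapunov [MeasurableSpace M] [BorelSpace M] {α : Type*}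
    [MeasurableSpace α] {σ : α → State d n M} (hf : ∀ i, MDifferentiable (𝓡 d) 𝓘(ℝ, ℝ) (f i))
    (hpoint : Measurable fun a => (σ a).point)
    (hvec : ∀ i, MeasurableField (fun a => (σ a).point) (fun a => (σ a).vec i)) (fstar b : ℝ) :
    Measurable fun a => (σ a).lyapunov f fstar b := by
  have hmean : MeasurableField (fun a => (σ a).point) (fun a => (σ a).mean) :=
    (MeasurableField.sum hvec).const_smul _
  have herr : MeasurableField (fun a => (σ a).point) (fun a => (σ a).err f) :=
    hmean.sub (measurableField_grad (mdifferentiable_average hf) hpoint)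
  exact (((mdifferentiable_average hf).continuous.measurable.comp hpoint).sub_const fstar).add
    ((herr.norm_sq hpoint).const_mul b)

variable [MeasurableSpace S] {ν : Measure S} {omega : ℝ}
  {Q : Fin n → (x : M) → S → TangentSpace (𝓡 d) x → TangentSpace (𝓡 d) x}

lemma State.measurable_lyapunov_step {α : Type*} {mα : MeasurableSpace α} {η : ℝ}
    {σ : α → State d n M} (hn : 0 < n) (hf : ∀ i, MDifferentiable (𝓡 d) 𝓘(ℝ, ℝ) (f i))
    (hQ : ∀ i, IsUnbiasedCompressor ν omega (Q i))
    (hmove : ∀ i, Measurable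
      fun a => (⟨(σ a).next η, (σ a).move η ((σ a).vec i)⟩ : TangentBundle (𝓡 d) M))
    (hdiff : ∀ i, Measurable
      fun a => (⟨(σ a).next η, (σ a).diff f η i⟩ : TangentBundle (𝓡 d) M)) (fstar b : ℝ) :
    Measurable fun q : α × (Bool × (Fin n → S)) =>
      ((σ q.1).step f Q η q.2.1 q.2.2).lyapunov f fstar b := by
  borelize M
  have hnext : Measurable fun q : α × (Bool × (Fin n → S)) => (σ q.1).next η :=
    (measurable_of_measurable_tangentBundle (hmove ⟨0, hn⟩)).comp measurable_fst
  have hcoin : MeasurableSet {q : α × (Bool × (Fin n → S)) | q.2.1 = true} :=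
    (measurable_fst.comp measurable_snd) (measurableSet_singleton true)
  refine measurable_lyapunov (σ := fun q : α × (Bool × (Fin n → S)) =>
    (σ q.1).step f Q η q.2.1 q.2.2) hf hnext (fun i => ?_) fstar b
  have hseed : Measurable fun q : α × (Bool × (Fin n → S)) =>
      (q.2.2 i, (⟨(σ q.1).next η, (σ q.1).diff f η i⟩ : TangentBundle (𝓡 d) M)) :=
    ((measurable_pi_apply i).comp (measurable_snd.comp measurable_snd)).prodMk
      ((hdiff i).comp measurable_fst)
  exact (measurableField_grad (hf i) hnext).ite hcoin
    ((MeasurableField.of_measurable ((hmove i).comp measurable_fst)).add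
      (MeasurableField.of_measurable ((hQ i).measurable.comp hseed)))

lemma lintegral_lyapunov_run_le (hM : GeodesicallyComplete d M) (hn : 0 < n)
    {L μ fstar p γ : ℝ} (hL : 0 < L) (hμ : 0 < μ) (hf : ∀ i, GSmooth (d := d) L (f i))
    (hPL : PLCondition d μ fstar (average f)) [IsProbabilityMeasure ν] (homega : 0 ≤ omega)
    (hQ : ∀ i, IsUnbiasedCompressor ν omega (Q i)) (hp : 0 < p) (hp1 : p ≤ 1) (hγ : 0 ≤ γ)
    (hγle : γ ≤ min (1 / (L * (1 + √(2 * (1 - p) * omega / (p * n))))) (p / (2 * μ))) (x₀ : M)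
    {Ω : Type*} {mΩ : MeasurableSpace Ω} {P : Measure Ω} [IsProbabilityMeasure P]
    (ℱ : Filtration ℕ mΩ) {Z : ℕ → Ω → Bool × (Fin n → S)} (hZ : ∀ k, Measurable (Z k))
    (hlaw : ∀ k, P.map (Z k) = stepLaw n p ν)
    (hind : ∀ k, Indep (MeasurableSpace.comap (Z k) inferInstance) (ℱ k) P)
    (hadapted : Adapted ℱ f γ (fun k a => run f Q γ x₀ (fun j => Z j a) k)) (K : ℕ) :
    ∫⁻ a, ENNReal.ofReal ((run f Q γ x₀ (fun j => Z j a) K).lyapunov f fstar (γ / p)) ∂P ≤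
      ENNReal.ofReal ((1 - γ * μ) ^ K * (average f x₀ - fstar)) := by
  have hmeas (k : ℕ) := (State.measurable_lyapunov_step (mα := ℱ k) hn (fun i => (hf i).1) hQ
    (fun i => (hadapted k i).2.2.1) (fun i => (hadapted k i).2.2.2) fstar (γ / p)).ennreal_ofReal
  have hγμ : 0 ≤ 1 - γ * μ := by
    linarith [mul_le_half_of_le_div hμ (hγle.trans (min_le_right _ _))]
  have hpow := lintegral_le_pow_mul_of_indep ℱ hZ hlaw hind
    (ξ := fun k a => run f Q γ x₀ (fun j => Z j a) k) (T := fun z σ => σ.step f Q γ z.1 z.2)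
    (fun _ _ => rfl) hmeas ENNReal.ofReal_ne_top
    (State.lintegral_lyapunov_step_le hM hn hL hμ hf hPL homega hQ hp hp1 hγ hγle) K
  simp only [lyapunov_run_zero f Q γ fstar (γ / p) x₀ _ fun i => (hf i).1 x₀, lintegral_const,
    measure_univ, mul_one] at hpow
  rwa [← ENNReal.ofReal_pow hγμ, ← ENNReal.ofReal_mul (pow_nonneg hγμ K)] at hpow

end Convergence

end RMarina

end

open RMarina in
theorem mainTheorem11 {d n : ℕ} (hn : 0 < n)
    -- a geodesically complete smooth Riemannian manifold
    {M : Type*} [TopologicalSpace M] [T2Space M] [SecondCountableTopology M]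
    [ChartedSpace (EuclideanSpace ℝ (Fin d)) M] [IsManifold (𝓡 d) ∞ M]
    [RiemannianBundle (fun x : M => TangentSpace (𝓡 d) x)]
    [IsContMDiffRiemannianBundle (𝓡 d) ∞ (EuclideanSpace ℝ (Fin d))
      (fun x : M => TangentSpace (𝓡 d) x)]
    (hM : RMarina.GeodesicallyComplete d M)
    -- the objective
    (f : Fin n → M → ℝ) (L μ fstar : ℝ) (hL : 0 < L) (hμ : 0 < μ)
    (hsmooth : ∀ i, RMarina.GSmooth (d := d) L (f i))
    (hPL : RMarina.PLCondition d μ fstar (RMarina.average f))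
    -- the compressors
    {S : Type*} [MeasurableSpace S] (ν : Measure S) [IsProbabilityMeasure ν]
    (omega : ℝ) (homega : 0 ≤ omega)
    (Q : Fin n → (x : M) → S → TangentSpace (𝓡 d) x → TangentSpace (𝓡 d) x)
    (hQ : ∀ i, RMarina.IsUnbiasedCompressor ν omega (Q i))
    -- the parameters of the method
    (p γ : ℝ) (hp : 0 < p) (hp1 : p ≤ 1) (hγ : 0 < γ)
    (hγle : γ ≤ min (1 / (L * (1 + √(2 * (1 - p) * omega / (p * n))))) (p / (2 * μ)))
    (x₀ : M)
    -- the randomness: coin and seeds of iteration `k` are independent of the past `ℱ k`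
    {Ω : Type*} [mΩ : MeasurableSpace Ω] (P : Measure Ω) [IsProbabilityMeasure P]
    (ℱ : Filtration ℕ mΩ) (Z : ℕ → Ω → Bool × (Fin n → S))
    (hZmeas : ∀ k, Measurable[ℱ (k + 1)] (Z k))
    (hZlaw : ∀ k, P.map (Z k) = RMarina.stepLaw n p ν)
    (hZindep : ∀ k, Indep (MeasurableSpace.comap (Z k) inferInstance) (ℱ k) P)
    (hadapted : RMarina.Adapted ℱ f γ
      (fun k a => RMarina.run f Q γ x₀ (fun j => Z j a) k))
    (K : ℕ) :
    Integrable (fun a => RMarina.average f (RMarina.iterate f Q γ x₀ Z K a)) P ∧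
    ∫ a, (RMarina.average f (RMarina.iterate f Q γ x₀ Z K a) - fstar) ∂P
      ≤ (1 - γ * μ) ^ K * (RMarina.average f x₀ - fstar) ∧
    ∀ xstar : M, (∀ y, RMarina.average f xstar ≤ RMarina.average f y) →
      ∫ a, (RMarina.average f (RMarina.iterate f Q γ x₀ Z K a) - RMarina.average f xstar) ∂P
        ≤ (1 - γ * μ) ^ K * (RMarina.average f x₀ - RMarina.average f xstar) := by
  have hγμ : 0 ≤ 1 - γ * μ := by
    linarith [mul_le_half_of_le_div hμ (hγle.trans (min_le_right _ _))]
  have hgap (x : M) : 0 ≤ average f x - fstar := sub_nonneg.2 (hPL.1 x)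
  have hlyapunov := lintegral_lyapunov_run_le hM hn hL hμ hsmooth hPL homega hQ hp hp1 hγ.le hγle x₀
    ℱ (fun k => (hZmeas k).mono (ℱ.le _) le_rfl) hZlaw hZindep hadapted K
  have hmeas : Measurable fun a => average f (iterate f Q γ x₀ Z K a) - fstar := by
    borelize M
    exact ((mdifferentiable_average fun i => (hsmooth i).1).continuous.measurable.comp
      (measurable_of_measurable_tangentBundle
        ((hadapted K ⟨0, hn⟩).1.mono (ℱ.le K) le_rfl))).sub_const fstar
  obtain ⟨hint, hle⟩ := integrable_and_integral_le_of_lintegral_ofReal_le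
    hmeas.aestronglyMeasurable (Filter.Eventually.of_forall fun a => hgap _)
    (mul_nonneg (pow_nonneg hγμ K) (hgap x₀))
    ((lintegral_mono fun a => ENNReal.ofReal_le_ofReal
      (le_add_of_nonneg_right (by positivity))).trans hlyapunov)
  refine ⟨?_, hle, fun xstar hxstar => ?_⟩
  · exact (hint.add (integrable_const fstar)).congr
      (Filter.Eventually.of_forall fun a => sub_add_cancel _ _)
  · rw [hPL.eq_of_forall_le hM hL hμ (GSmooth.average hn hsmooth) hxstar]
    exact hle
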